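/- Let $n\ge 3$, and let $K(n,n)$ be the complete bipartite graph with both partite sets of size $n$. For an edge-colouring of $K(n,n)$ with three colours, the colour degree of a vertex is the number of distinct colours on the edges incident with it. A monochromatic tree is a subgraph that is a tree all of whose edges have the same colour; single vertices count as monochromatic trees. Then the least integer $k$ such that, for every edge-colouring of $K(n,n)$ with three colours in which every vertex has colour degree $3$, the vertices of $K(n,n)$ can be covered by at most $k$ vertex-disjoint monochromatic trees, is $k=3$; that is, $t_3(K(n,n))=3$ for this class of colourings. In other words: for every such colouring the vertices can be covered by at most three vertex-disjoint monochromatic trees, and for every $n\ge 3$ there is such a colouring for which they cannot be covered by two or fewer. -/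

import Mathlib

namespace MonoTree

variable {V : Type*} {G : SimpleGraph V} {r : ℕ}

/-- The colour degree of a vertex `v` in an `r`-edge-coloured graph: the number of distinct colours
appearing on the edges incident with `v`. -/
noncomputable def colorDegree (c : G.EdgeLabeling (Fin r)) (v : V) : ℕ :=
  Set.ncard {i : Fin r | ∃ (w : V) (h : G.Adj v w), c.get v w h = i}

/-- A subgraph is monochromatic if some colour is the colour of all of its edges
(a subgraph without edges qualifies, as soon as there is a colour at all). -/
def IsMonochromatic (c : G.EdgeLabeling (Fin r)) (H : G.Subgraph) : Prop :=
  ∃ i : Fin r, ∀ (v w : V) (h : H.Adj v w), c.get v w h.adj_sub = i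

/-- The vertices of the coloured graph can be covered by at most `k` vertex-disjoint monochromatic
trees. A tree is a nonempty connected acyclic subgraph; single vertices are allowed. -/
def CoverableByTrees (c : G.EdgeLabeling (Fin r)) (k : ℕ) : Prop :=
  ∃ m ≤ k, ∃ T : Fin m → G.Subgraph,
    (∀ j, (T j).coe.IsTree) ∧
    (∀ j, IsMonochromatic c (T j)) ∧
    (∀ j j', j ≠ j' → Disjoint (T j).verts (T j').verts) ∧
    (∀ v : V, ∃ j, v ∈ (T j).verts)

/-- `k` is the (monochromatic) tree partition number of `G` for the `r`-edge-colourings in the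
class `P`: the least integer `k` such that, for every colouring in `P`, the vertices of `G` can be
covered by at most `k` vertex-disjoint monochromatic trees. -/
def IsTreePartitionNumber (G : SimpleGraph V) (r : ℕ) (P : G.EdgeLabeling (Fin r) → Prop)
    (k : ℕ) : Prop :=
  IsLeast {k : ℕ | ∀ c : G.EdgeLabeling (Fin r), P c → CoverableByTrees c k} k

end MonoTree

/-! Lower bound: in a blow-up of the Latin square of order three, a monochromatic connected subgraph
meets only one of the three left blocks (`block_eq_of_connected`), so three trees are needed.

Upper bound: it suffices to split the vertices into at most three parts, each connected in one
colour, and take spanning trees. Suppose this is impossible. Then every colour has at least four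
components. For a union `S` of components of one colour, `Twist S` and its complement carry only the
two other colours. Connectivity of two-coloured complete bipartite graphs then forces pairwise
disjoint components of colours 0, 1, 2 (`exists_triple`). Zone `i` consists of the vertices whose
component of colour `i` avoids the other two chosen components. Zones are disjoint, edges between
two zones have the third colour, and zone `i` contains at least three components of colour `i`
(`Critical.exists_three`).

This yields a skeleton (`Critical.partitionable_of_outer`): part `k` is a pair of stars of colour
`k` between zones `k + 1` and `k + 2`, centred at one chosen vertex of zone `k + 2` on each side,
the two stars being joined by a link vertex or by an edge inside zone `k + 1`. The chosen vertices
on one side form a menu for the outer vertices of the other side. An outer vertex that can be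
attached to no part is killed by the menu. Distinct menus kill disjoint sets, so averaging gives
three disjoint menus that kill few vertices (`Critical.exists_menus`). The killed vertices are saved
through vertices of the opposite side (`rescuable_of_card`); since both sides have the same size,
there are enough of those. -/

/-- A complete bipartite graph on `V` (two vertices are adjacent when their sides differ) whose
edges are coloured with three colours. -/
structure BiColoring (V : Type*) where
  side : V → Bool
  col : V → V → Fin 3
  col_comm : ∀ v w, col v w = col w v

/-! ### Monochromatic components, and partitions into connected parts as tree covers -/

namespace BiColoring

variable {V : Type*} (c : BiColoring V)

/-- `v` and `w` are joined by an edge of colour `k`. -/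
def Step (k : Fin 3) (v w : V) : Prop := c.side v ≠ c.side w ∧ c.col v w = k

/-- `v` and `w` lie in the same component of colour `k`. -/
def Linked (k : Fin 3) : V → V → Prop := Relation.ReflTransGen (c.Step k)

/-- The adjacency of the union of the graphs of colour `κ p` on the parts `f ⁻¹ p`. -/
def PartStep (f κ : V → Fin 3) (v w : V) : Prop := f v = f w ∧ c.Step (κ v) v w

/-- The vertices can be split into at most three parts, each connected in some colour. -/
def Partitionable : Prop :=
  ∃ (f : V → Fin 3) (κ : Fin 3 → Fin 3) (root : Fin 3 → V),
    ∀ v, Relation.ReflTransGen (c.PartStep f (κ ∘ f)) v (root (f v))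

variable {c}

theorem Step.symm {k : Fin 3} {v w : V} (h : c.Step k v w) : c.Step k w v :=
  ⟨h.1.symm, by rw [c.col_comm]; exact h.2⟩

theorem Linked.symm {k : Fin 3} {v w : V} (h : c.Linked k v w) : c.Linked k w v :=
  by
  induction h with
  | refl => exact Relation.ReflTransGen.refl
  | tail _ h ih => exact Relation.ReflTransGen.head h.symm ih

theorem Step.linked {k : Fin 3} {v w : V} (h : c.Step k v w) : c.Linked k v w :=
  Relation.ReflTransGen.single h

theorem Linked.trans {k : Fin 3} {u v w : V} (h : c.Linked k u v) (h' : c.Linked k v w) :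
    c.Linked k u w :=
  Relation.ReflTransGen.trans h h'

@[refl] theorem Linked.refl {k : Fin 3} (v : V) : c.Linked k v v := Relation.ReflTransGen.refl

theorem PartStep.symm {f : V → Fin 3} {κ : Fin 3 → Fin 3} {v w : V}
    (h : c.PartStep f (κ ∘ f) v w) : c.PartStep f (κ ∘ f) w v :=
  ⟨h.1.symm, by simpa [Function.comp, h.1] using h.2.symm⟩

/-- The edge colouring of the balanced complete bipartite graph as a `BiColoring`. -/
noncomputable def ofLabeling {α β : Type*}
    (c : (completeBipartiteGraph α β).EdgeLabeling (Fin 3)) : BiColoring (α ⊕ β) where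
  side := Sum.isRight
  col v w := by
    classical
    -- The value on non-edges is harmless, because `Step` also demands different sides.
    exact if h : (completeBipartiteGraph α β).Adj v w then c.get v w h else 0
  col_comm v w := by
    classical
    by_cases h : (completeBipartiteGraph α β).Adj v w
    · rw [dif_pos h, dif_pos h.symm, SimpleGraph.EdgeLabeling.get_comm]
    · rw [dif_neg h, dif_neg (fun h' => h h'.symm)]

theorem adj_iff_side {α β : Type*} (c : (completeBipartiteGraph α β).EdgeLabeling (Fin 3))
    (v w : α ⊕ β) :
    (completeBipartiteGraph α β).Adj v w ↔ (ofLabeling c).side v ≠ (ofLabeling c).side w := by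
  cases v <;> cases w <;> simp [ofLabeling]

theorem step_ofLabeling {α β : Type*} (c : (completeBipartiteGraph α β).EdgeLabeling (Fin 3))
    (k : Fin 3) (v w : α ⊕ β) :
    (ofLabeling c).Step k v w ↔
      ∃ h : (completeBipartiteGraph α β).Adj v w, c.get v w h = k := by
  classical
  constructor
  · rintro ⟨h1, h2⟩
    have h := (adj_iff_side c v w).2 h1
    refine ⟨h, ?_⟩
    rw [← h2]
    exact (dif_pos h).symm
  · rintro ⟨h, h2⟩
    refine ⟨(adj_iff_side c v w).1 h, ?_⟩
    rw [← h2]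
    exact dif_pos h

theorem coverable_of_partitionable {α β : Type*}
    (c : (completeBipartiteGraph α β).EdgeLabeling (Fin 3))
    (h : (ofLabeling c).Partitionable) : MonoTree.CoverableByTrees c 3 := by
  classical
  obtain ⟨f, κ, root, hf⟩ := h
  let H : (p : Fin 3) → SimpleGraph {v // f v = p} := fun p =>
    { Adj := fun a b => (ofLabeling c).Step (κ p) a b
      symm := ⟨fun _ _ h => h.symm⟩
      loopless := ⟨fun _ h => h.1 rfl⟩ }
  have hreach : ∀ p (a b : α ⊕ β) (ha : f a = p) (hb : f b = p),
      Relation.ReflTransGen ((ofLabeling c).PartStep f (κ ∘ f)) a b →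
      (H p).Reachable ⟨a, ha⟩ ⟨b, hb⟩ := by
    intro p a b ha hb hab
    induction hab using Relation.ReflTransGen.head_induction_on with
    | refl => exact SimpleGraph.Reachable.refl _
    | head h1 _ ih =>
      rename_i u v _
      have hv : f v = p := h1.1 ▸ ha
      refine SimpleGraph.Reachable.trans (SimpleGraph.Adj.reachable ?_) (ih hv)
      have := h1.2
      simpa [H, ha] using this
  have hroot : ∀ v, f (root (f v)) = f v := by
    intro v
    have key : ∀ a b, Relation.ReflTransGen ((ofLabeling c).PartStep f (κ ∘ f)) a b →
        f a = f b := by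
      intro a b hab
      induction hab with
      | refl => rfl
      | tail _ h ih => exact ih.trans h.1
    exact (key _ _ (hf v)).symm
  -- Empty parts are discarded, since a tree must be nonempty.
  let ι := {p : Fin 3 // ∃ v, f v = p}
  have hconn : ∀ p : ι, (H p.1).Connected := by
    rintro ⟨p, v, hv⟩
    rw [SimpleGraph.connected_iff_exists_forall_reachable]
    subst hv
    refine ⟨⟨root (f v), hroot v⟩, ?_⟩
    rintro ⟨w, hw⟩
    refine (hreach _ _ _ hw (hroot v) ?_).symm
    have h := hf w
    rwa [show f w = f v from hw] at h
  choose T hT hTree using fun p : ι => (hconn p).exists_isTree_le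
  let S : ι → (completeBipartiteGraph α β).Subgraph := fun p =>
    { verts := {v | f v = p.1}
      Adj := fun a b => ∃ (ha : f a = p.1) (hb : f b = p.1), (T p).Adj ⟨a, ha⟩ ⟨b, hb⟩
      adj_sub := by
        rintro a b ⟨ha, hb, hab⟩
        exact ((step_ofLabeling c _ _ _).1 (hT p hab)).1
      edge_vert := by
        rintro a b ⟨ha, _, _⟩
        exact ha
      symm := ⟨by
        rintro a b ⟨ha, hb, hab⟩
        exact ⟨hb, ha, hab.symm⟩⟩ }
  have hcard : Fintype.card ι ≤ 3 :=
    (Fintype.card_subtype_le _).trans_eq (Fintype.card_fin 3)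
  let e := (Fintype.equivFin ι).symm
  refine ⟨Fintype.card ι, hcard, fun j => S (e j), ?_, ?_, ?_, ?_⟩
  · intro j
    have : (S (e j)).coe = T (e j) := by
      ext a b
      constructor
      · rintro ⟨_, _, h⟩
        exact h
      · intro h
        exact ⟨a.2, b.2, h⟩
    show (S (e j)).coe.IsTree
    rw [this]
    exact hTree (e j)
  · intro j
    refine ⟨κ (e j).1, ?_⟩
    rintro v w ⟨ha, hb, h⟩
    exact ((step_ofLabeling c _ _ _).1 (hT (e j) h)).2
  · intro j j' hjj
    rw [Set.disjoint_left]
    intro v hv hv'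
    apply hjj
    apply e.injective
    apply Subtype.ext
    exact (show f v = (e j).1 from hv).symm.trans hv'
  · intro v
    refine ⟨e.symm ⟨f v, v, rfl⟩, ?_⟩
    show f v = (e (e.symm ⟨f v, v, rfl⟩)).1
    simp

theorem exists_step_of_colorDegree {α β : Type*}
    (c : (completeBipartiteGraph α β).EdgeLabeling (Fin 3)) {v : α ⊕ β}
    (h : MonoTree.colorDegree c v = 3) (k : Fin 3) : ∃ w, (ofLabeling c).Step k v w := by
  classical
  have huniv : {i : Fin 3 | ∃ (w : α ⊕ β) (h : (completeBipartiteGraph α β).Adj v w),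
      c.get v w h = i} = Set.univ := by
    apply Set.eq_of_subset_of_ncard_le (Set.subset_univ _)
    rw [Set.ncard_univ]
    simpa [MonoTree.colorDegree] using h.ge
  have hk := Set.mem_univ k
  rw [← huniv] at hk
  obtain ⟨w, hw, hc⟩ := hk
  exact ⟨w, (step_ofLabeling c k v w).2 ⟨hw, hc⟩⟩

end BiColoring

/-! ### The lower bound: blown-up Latin square -/

/-- The block of an index: `0`, `1`, or `2` for all the other indices. -/
def block (i : ℕ) : Fin 3 := if i = 0 then 0 else if i = 1 then 1 else 2

theorem block_surjective {n : ℕ} (hn : 3 ≤ n) (k : Fin 3) : ∃ i : Fin n, block i = k := by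
  fin_cases k
  · exact ⟨⟨0, by omega⟩, rfl⟩
  · exact ⟨⟨1, by omega⟩, rfl⟩
  · exact ⟨⟨2, by omega⟩, rfl⟩

/-- The block of a vertex of `K(n,n)`. -/
def vertexBlock {n : ℕ} : Fin n ⊕ Fin n → Fin 3
  | .inl i => block i
  | .inr i => block i

/-- The blow-up of the Latin square of order three, as an edge colouring of `K(n,n)`. -/
def latinLabeling (n : ℕ) : (completeBipartiteGraph (Fin n) (Fin n)).EdgeLabeling (Fin 3) :=
  SimpleGraph.EdgeLabeling.mk (fun v w _ => vertexBlock v + vertexBlock w)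
    (fun _ _ _ => add_comm _ _)

theorem colorDegree_latinLabeling {n : ℕ} (hn : 3 ≤ n) (v : Fin n ⊕ Fin n) :
    MonoTree.colorDegree (latinLabeling n) v = 3 := by
  have huniv : {i : Fin 3 | ∃ (w : Fin n ⊕ Fin n)
      (h : (completeBipartiteGraph (Fin n) (Fin n)).Adj v w),
      (latinLabeling n).get v w h = i} = Set.univ := by
    ext k
    simp only [Set.mem_univ, iff_true]
    obtain ⟨i, hi⟩ := block_surjective hn (k - vertexBlock v)
    cases v with
    | inl a =>
      refine ⟨.inr i, by simp, ?_⟩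
      rw [latinLabeling, SimpleGraph.EdgeLabeling.get_mk]
      show vertexBlock (Sum.inl a) + block i = k
      rw [hi]; abel
    | inr a =>
      refine ⟨.inl i, by simp, ?_⟩
      rw [latinLabeling, SimpleGraph.EdgeLabeling.get_mk]
      show vertexBlock (Sum.inr a) + block i = k
      rw [hi]; abel
  rw [MonoTree.colorDegree, huniv, Set.ncard_univ]
  simp

/-- In a monochromatic connected subgraph of the blown-up Latin square, all left vertices lie in
the same block. -/
theorem block_eq_of_connected {n : ℕ} {H : (completeBipartiteGraph (Fin n) (Fin n)).Subgraph}
    (hH : H.coe.Preconnected) (hmono : MonoTree.IsMonochromatic (latinLabeling n) H)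
    {a b : Fin n} (ha : Sum.inl a ∈ H.verts) (hb : Sum.inl b ∈ H.verts) :
    block a = block b := by
  obtain ⟨k, hk⟩ := hmono
  -- An edge of colour `k` joins blocks with sum `k`, so `g` is constant along such edges.
  let g : Fin n ⊕ Fin n → Fin 3 := fun v => match v with
    | .inl i => block i
    | .inr i => k - block i
  have hg : ∀ u v : H.verts, H.coe.Reachable u v → g u = g v := by
    intro u v huv
    rw [SimpleGraph.reachable_iff_reflTransGen] at huv
    induction huv with
    | refl => rfl
    | tail _ h ih =>
      rename_i v w _
      rw [ih]
      have h1 : H.Adj v w := h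
      have h2 := hk _ _ h1
      rw [latinLabeling, SimpleGraph.EdgeLabeling.get_mk] at h2
      have h3 := h1.adj_sub
      obtain ⟨v, hv⟩ := v
      obtain ⟨w, hw⟩ := w
      cases v <;> cases w <;> simp [vertexBlock, g] at h2 h3 ⊢
      · rw [← h2]; abel
      · rw [← h2]; abel
  exact hg ⟨_, ha⟩ ⟨_, hb⟩ (hH _ _)

theorem three_le_of_coverable_latinLabeling {n : ℕ} (hn : 3 ≤ n) {k : ℕ}
    (h : MonoTree.CoverableByTrees (latinLabeling n) k) : 3 ≤ k := by
  obtain ⟨m, hm, T, hT, hmono, -, hcov⟩ := h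
  choose i hi using fun k => block_surjective hn k
  choose j hj using fun k => hcov (Sum.inl (i k))
  have hinj : Function.Injective j := by
    intro a b hab
    have hb := hj b
    rw [← hab] at hb
    have := block_eq_of_connected (hT (j a)).1.1 (hmono _) (hj a) hb
    rwa [hi, hi] at this
  have := Fintype.card_le_of_injective j hinj
  simp at this
  omega

/-! ### Without a partition there are disjoint components of the three colours -/

theorem Fin.eq_third {a b d x : Fin 3} (hab : a ≠ b) (hbd : b ≠ d) (had : a ≠ d) (ha : x ≠ a)
    (hb : x ≠ b) : x = d := by
  omega

namespace BiColoring

variable {V : Type*} {c : BiColoring V}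

variable (c) in
/-- Every vertex is incident with edges of all three colours. -/
def FullDegree : Prop := ∀ v k, ∃ w, c.Step k v w

variable (c) in
/-- Any two vertices satisfying `U` are joined by a path of colour `k` inside `U`. -/
def ConnOn (k : Fin 3) (U : V → Prop) : Prop :=
  ∀ v w, U v → U w → Relation.ReflTransGen (fun a b => U a ∧ U b ∧ c.Step k a b) v w

variable (c) in
/-- The set `S` is a union of components of colour `k`. -/
def Closed (k : Fin 3) (S : V → Prop) : Prop := ∀ v w, c.Step k v w → (S v ↔ S w)

theorem partitionable_of_connOn [Nonempty V] (f : V → Fin 3) (κ : Fin 3 → Fin 3)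
    (h : ∀ p, c.ConnOn (κ p) (fun v => f v = p)) : c.Partitionable := by
  classical
  refine ⟨f, κ, fun p => if hp : ∃ v, f v = p then hp.choose else Classical.arbitrary V, ?_⟩
  intro v
  have hp : ∃ w, f w = f v := ⟨v, rfl⟩
  simp only [dif_pos hp]
  refine Relation.ReflTransGen.mono ?_ _ _ (h (f v) v _ rfl hp.choose_spec)
  rintro a b ⟨ha, hb, hab⟩
  exact ⟨ha.trans hb.symm, by simpa [Function.comp, ha] using hab⟩

theorem partitionable_of_two [Nonempty V] {β γ : Fin 3} {U : V → Prop} (h : c.ConnOn β U)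
    (h' : c.ConnOn γ (fun v => ¬ U v)) : c.Partitionable := by
  classical
  -- The third part is empty, so its colour is arbitrary.
  refine partitionable_of_connOn (fun v => if U v then 0 else 1) ![β, γ, γ] ?_
  intro p
  fin_cases p
  · intro v w hv hw
    simp only [Fin.zero_eta, ite_eq_left_iff, one_ne_zero, imp_false, not_not] at hv hw
    refine Relation.ReflTransGen.mono ?_ _ _ (h v w hv hw)
    rintro a b ⟨ha, hb, hab⟩
    exact ⟨by simp [ha], by simp [hb], hab⟩
  · intro v w hv hw
    simp at hv hw
    refine Relation.ReflTransGen.mono ?_ _ _ (h' v w hv hw)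
    rintro a b ⟨ha, hb, hab⟩
    exact ⟨by simp [ha], by simp [hb], hab⟩
  · intro v w hv
    exfalso
    by_cases hU : U v <;> simp [hU] at hv

theorem Closed.linked {k : Fin 3} {S : V → Prop} (hS : c.Closed k S) {v w : V}
    (h : c.Linked k v w) : S v ↔ S w := by
  induction h with
  | refl => rfl
  | tail _ h ih => exact ih.trans (hS _ _ h)

theorem closed_linked (k : Fin 3) (u : V) : c.Closed k (fun v => c.Linked k v u) :=
  fun _ _ h => ⟨fun h' => h.symm.linked.trans h', fun h' => h.linked.trans h'⟩

theorem Closed.not {k : Fin 3} {S : V → Prop} (hS : c.Closed k S) :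
    c.Closed k (fun v => ¬ S v) := fun v w h => not_congr (hS v w h)

/-- Without a partition, no colour has three components covering everything. -/
theorem exists_not_linked (hP : ¬ c.Partitionable) (k : Fin 3) (u₁ u₂ u₃ : V) :
    ∃ v, ¬ c.Linked k v u₁ ∧ ¬ c.Linked k v u₂ ∧ ¬ c.Linked k v u₃ := by
  classical
  by_contra hcon
  push Not at hcon
  apply hP
  refine ⟨fun v => if c.Linked k v u₁ then 0 else if c.Linked k v u₂ then 1 else 2, fun _ => k,
    ![u₁, u₂, u₃], ?_⟩
  intro v
  have key : ∀ w, c.Linked k v w → Relation.ReflTransGen (c.PartStep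
      (fun v => if c.Linked k v u₁ then 0 else if c.Linked k v u₂ then 1 else 2)
      ((fun _ => k) ∘ fun v => if c.Linked k v u₁ then (0 : Fin 3) else
        if c.Linked k v u₂ then 1 else 2)) v w := by
    intro w hw
    induction hw with
    | refl => exact Relation.ReflTransGen.refl
    | tail _ h ih =>
      refine ih.tail ⟨?_, h⟩
      simp only [(closed_linked k u₁).linked h.linked, (closed_linked k u₂).linked h.linked]
  apply key
  by_cases h1 : c.Linked k v u₁
  · simp [h1]
  · by_cases h2 : c.Linked k v u₂
    · simp [h1, h2]
    · simpa [h1, h2] using hcon v h1 h2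

/-- The vertices of `S` on the side `false` and the vertices outside `S` on the side `true`. -/
def Twist (c : BiColoring V) (S : V → Prop) (v : V) : Prop := S v ↔ c.side v = false

theorem twist_not (S : V → Prop) : c.Twist (fun v => ¬ S v) = fun v => ¬ c.Twist S v := by
  funext v
  simp only [Twist, eq_iff_iff]
  tauto

theorem Closed.col_ne {k : Fin 3} {S : V → Prop} (hS : c.Closed k S) {v w : V}
    (hv : S v) (hw : ¬ S w) (hs : c.side v ≠ c.side w) : c.col v w ≠ k :=
  fun h => hw ((hS v w ⟨hs, h⟩).1 hv)

theorem Closed.col_ne_of_twist {k : Fin 3} {S : V → Prop} (hS : c.Closed k S) {v w : V}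
    (hv : c.Twist S v) (hw : c.Twist S w) (hs : c.side v ≠ c.side w) : c.col v w ≠ k := by
  intro h
  have := hS v w ⟨hs, h⟩
  unfold Twist at hv hw
  cases h1 : c.side v <;> cases h2 : c.side w <;> simp_all

/-- No edge inside the twist has colour `α`, so vertices on different sides and in different
components of colour `β` are joined by an edge of colour `γ`. The two hypotheses provide enough
components of colour `β` to link any two vertices by such edges. -/
theorem connOn_twist {α β γ : Fin 3} (hαβ : α ≠ β) (hβγ : β ≠ γ) (hαγ : α ≠ γ) {S : V → Prop}
    (hS : c.Closed α S)
    (hside : ∀ b, ∃ y z, c.Twist S y ∧ c.Twist S z ∧ c.side y = b ∧ c.side z = b ∧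
      ¬ c.Linked β y z)
    (h3 : ∃ x y z, c.Twist S x ∧ c.Twist S y ∧ c.Twist S z ∧ ¬ c.Linked β x y ∧
      ¬ c.Linked β x z ∧ ¬ c.Linked β y z) : c.ConnOn γ (c.Twist S) := by
  have step : ∀ v w, c.Twist S v → c.Twist S w → c.side v ≠ c.side w → ¬ c.Linked β v w →
      Relation.ReflTransGen (fun a b => c.Twist S a ∧ c.Twist S b ∧ c.Step γ a b) v w := by
    intro v w hv hw hs hl
    refine Relation.ReflTransGen.single ⟨hv, hw, hs, ?_⟩
    exact Fin.eq_third hαβ hβγ hαγ (hS.col_ne_of_twist hv hw hs)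
      (fun h => hl (Step.linked ⟨hs, h⟩))
  have same : ∀ v w, c.Twist S v → c.Twist S w → c.side v = c.side w →
      Relation.ReflTransGen (fun a b => c.Twist S a ∧ c.Twist S b ∧ c.Step γ a b) v w := by
    intro v w hv hw hs
    by_cases hy : ∃ y, c.Twist S y ∧ c.side y = !c.side v ∧ ¬ c.Linked β v y ∧ ¬ c.Linked β y w
    · obtain ⟨y, hy, hys, h1, h2⟩ := hy
      exact (step v y hv hy (by simp [hys]) h1).trans (step y w hy hw (by simp [hys, hs]) h2)
    push Not at hy
    have hvw : ¬ c.Linked β v w := by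
      intro hvw
      obtain ⟨y, z, hy1, hz1, hys, hzs, hyz⟩ := hside (!c.side v)
      have h1 : c.Linked β v y := by
        by_contra h
        exact h (hvw.trans (hy y hy1 hys h).symm)
      have h2 : c.Linked β v z := by
        by_contra h
        exact h (hvw.trans (hy z hz1 hzs h).symm)
      exact hyz (h1.symm.trans h2)
    obtain ⟨z, hz, hzv, hzw⟩ : ∃ z, c.Twist S z ∧ ¬ c.Linked β z v ∧ ¬ c.Linked β z w := by
      by_contra hcon
      push Not at hcon
      obtain ⟨x, y, z, hx, hy, hz, hxy, hxz, hyz⟩ := h3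
      have hx' := hcon x hx
      have hy' := hcon y hy
      have hz' := hcon z hz
      have key : ∀ (t a b : V), c.Linked β a t → c.Linked β b t → c.Linked β a b :=
        fun t a b h1 h2 => h1.trans h2.symm
      have k1 := fun t => key t x y
      have k2 := fun t => key t x z
      have k3 := fun t => key t y z
      by_cases h1 : c.Linked β x v <;> by_cases h2 : c.Linked β y v <;>
        by_cases h3 : c.Linked β z v
      all_goals first
        | exact hxy (k1 v h1 h2)
        | exact hxz (k2 v h1 h3)
        | exact hyz (k3 v h2 h3)
        | exact hxy (k1 w (hx' h1) (hy' h2))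
        | exact hxz (k2 w (hx' h1) (hz' h3))
        | exact hyz (k3 w (hy' h2) (hz' h3))
    have hzs : c.side z = c.side v := by
      by_contra h
      exact hzw (hy z hz (by simpa using (Bool.eq_not_of_ne h)) (fun h => hzv h.symm))
    obtain ⟨y, y', hyU, hyU', hys, hys', hyv, hyw⟩ : ∃ y y', c.Twist S y ∧ c.Twist S y' ∧
        c.side y = (!c.side v) ∧ c.side y' = (!c.side v) ∧ c.Linked β v y ∧
        c.Linked β y' w := by
      obtain ⟨y, z, hy1, hz1, hys, hzs, hyz⟩ := hside (!c.side v)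
      by_cases h1 : c.Linked β v y
      · have h2 : ¬ c.Linked β v z := fun h2 => hyz (h1.symm.trans h2)
        exact ⟨y, z, hy1, hz1, hys, hzs, h1, hy z hz1 hzs h2⟩
      · have h3 := hy y hy1 hys h1
        by_cases h2 : c.Linked β v z
        · exact ⟨z, y, hz1, hy1, hzs, hys, h2, h3⟩
        · exact absurd (h3.trans (hy z hz1 hzs h2).symm) hyz
    -- Here the opposite side meets only the components of `v` and `w`, so the path `v, y', z, y, w`
    -- changes component at each step.
    refine (step v y' hv hyU' (by simp [hys']) fun h => hvw (h.trans hyw)).trans ?_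
    refine (step y' z hyU' hz (by simp [hys', hzs]) fun h => hzw (h.symm.trans hyw)).trans ?_
    refine (step z y hz hyU (by simp [hys, hzs]) fun h => hzv (h.trans hyv.symm)).trans ?_
    exact step y w hyU hw (by simp [hys, hs]) fun h => hvw (hyv.trans h)
  intro v w hv hw
  by_cases hs : c.side v = c.side w
  · exact same v w hv hw hs
  by_cases hl : c.Linked β v w
  · obtain ⟨y, z, hy1, hz1, hys, hzs, hyz⟩ := hside (c.side w)
    obtain ⟨t, ht, hts, htv⟩ : ∃ t, c.Twist S t ∧ c.side t = c.side w ∧ ¬ c.Linked β v t := by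
      by_cases h1 : c.Linked β v y
      · exact ⟨z, hz1, hzs, fun h2 => hyz (h1.symm.trans h2)⟩
      · exact ⟨y, hy1, hys, h1⟩
    exact (step v t hv ht (hts ▸ hs) htv).trans (same t w ht hw hts)
  · exact step v w hv hw hs hl

theorem exists_twist [Nonempty V] (hdeg : c.FullDegree) {α : Fin 3} {S : V → Prop}
    (hS : c.Closed α S) : ∃ v, c.Twist S v := by
  obtain ⟨v⟩ := ‹Nonempty V›
  obtain ⟨w, hw⟩ := hdeg v α
  have h1 := hS v w hw
  have h2 := hw.1
  by_cases h : c.Twist S v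
  · exact ⟨v, h⟩
  · refine ⟨w, ?_⟩
    unfold Twist at h ⊢
    cases h3 : c.side v <;> cases h4 : c.side w <;> simp_all

theorem exists_linked_side (hdeg : c.FullDegree) (k : Fin 3) (v : V) (b : Bool) :
    ∃ w, c.side w = b ∧ c.Linked k v w := by
  by_cases hb : c.side v = b
  · exact ⟨v, hb, Linked.refl v⟩
  · obtain ⟨w, hw⟩ := hdeg v k
    refine ⟨w, ?_, hw.linked⟩
    have := hw.1
    cases h1 : c.side v <;> cases h2 : c.side w <;> cases b <;> simp_all

/-- The complement of the twist lies in one component of colour `β`. At least three further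
components exist, all inside the twist, and by full degree each meets both sides, so `connOn_twist`
applies. -/
theorem connOn_twist_of_connOn [Nonempty V] (hP : ¬ c.Partitionable) (hdeg : c.FullDegree)
    {α β γ : Fin 3} (hαβ : α ≠ β) (hβγ : β ≠ γ) (hαγ : α ≠ γ) {S : V → Prop}
    (hS : c.Closed α S) (h : c.ConnOn β (fun v => ¬ c.Twist S v)) :
    c.ConnOn γ (c.Twist S) := by
  obtain ⟨u, hu⟩ := exists_twist hdeg hS.not
  rw [twist_not] at hu
  have hU : ∀ v, ¬ c.Linked β v u → c.Twist S v := by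
    intro v hv
    by_contra hvS
    apply hv
    refine Relation.ReflTransGen.mono ?_ _ _ (h v u hvS hu)
    rintro a b ⟨_, _, hab⟩
    exact hab
  obtain ⟨v₁, h1, -, -⟩ := exists_not_linked hP β u u u
  obtain ⟨v₂, h2, h21, -⟩ := exists_not_linked hP β u v₁ u
  obtain ⟨v₃, h3, h31, h32⟩ := exists_not_linked hP β u v₁ v₂
  refine connOn_twist hαβ hβγ hαγ hS ?_
    ⟨v₁, v₂, v₃, hU _ h1, hU _ h2, hU _ h3, fun h => h21 h.symm, fun h => h31 h.symm,
      fun h => h32 h.symm⟩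
  intro b
  obtain ⟨w₁, hs1, hw1⟩ := exists_linked_side hdeg β v₁ b
  obtain ⟨w₂, hs2, hw2⟩ := exists_linked_side hdeg β v₂ b
  exact ⟨w₁, w₂, hU _ fun h => h1 (hw1.trans h), hU _ fun h => h2 (hw2.trans h), hs1, hs2,
    fun h => h21 ((hw1.trans h).trans hw2.symm).symm⟩

theorem exists_third {α β : Fin 3} (h : α ≠ β) : ∃ γ, β ≠ γ ∧ α ≠ γ := by
  revert α β; decide

/-- Otherwise the complement would be connected in the third colour, giving a partition into two
parts. -/
theorem not_connOn_twist [Nonempty V] (hP : ¬ c.Partitionable) (hdeg : c.FullDegree)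
    {α β : Fin 3} (hαβ : α ≠ β) {S : V → Prop} (hS : c.Closed α S) :
    ¬ c.ConnOn β (c.Twist S) := by
  intro h
  obtain ⟨γ, hβγ, hαγ⟩ := exists_third hαβ
  have h' : c.ConnOn γ (c.Twist (fun v => ¬ S v)) := by
    refine connOn_twist_of_connOn hP hdeg hαβ hβγ hαγ hS.not ?_
    rw [twist_not]
    simpa only [not_not] using h
  rw [twist_not] at h'
  exact hP (partitionable_of_two h h')

/-- The vertices of `S` on either side lie in one component of colour `β`. -/
def Single (c : BiColoring V) (β : Fin 3) (S : V → Prop) : Prop :=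
  ∀ v w, c.side v = c.side w → S v → S w → c.Linked β v w

/-- Such an `S` meets at most two components of colour `γ`. A vertex `t` of a further one, on the
opposite side, lies outside `S`, and its edges to `S` avoid `α` and `γ`. So `t` is a common
neighbour in colour `β`. -/
theorem Single.other (hP : ¬ c.Partitionable) (hdeg : c.FullDegree)
    {α β γ : Fin 3} (hαβ : α ≠ β) (hβγ : β ≠ γ) (hαγ : α ≠ γ) {S : V → Prop}
    (hS : c.Closed α S) (h : c.Single γ S) : c.Single β S := by
  intro v w hs hv hw
  obtain ⟨v', hv'⟩ := hdeg v α
  have hv'S : S v' := (hS v v' hv').1 hv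
  obtain ⟨z, hz1, hz2, -⟩ := exists_not_linked hP γ v v' v
  obtain ⟨t, hts, hzt⟩ := exists_linked_side hdeg γ z (!c.side v)
  have hall : ∀ x, S x → ¬ c.Linked γ t x := by
    intro x hx hl
    by_cases hxs : c.side x = c.side v
    · exact hz1 ((hzt.trans hl).trans (h x v hxs hx hv))
    · refine hz2 ((hzt.trans hl).trans (h x v' ?_ hx hv'S))
      have := hv'.1
      cases h1 : c.side x <;> cases h2 : c.side v <;> cases h3 : c.side v' <;> simp_all
  have htS : ¬ S t := fun ht => hall t ht (Linked.refl t)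
  have adj : ∀ x, S x → c.side x = c.side v → c.Linked β x t := by
    intro x hx hxs
    have hne : c.side x ≠ c.side t := by simp [hts, hxs]
    refine Step.linked ⟨hne, Fin.eq_third hαγ hβγ.symm hαβ (hS.col_ne hx htS hne) fun hc => ?_⟩
    exact hall x hx (Step.linked ⟨hne, hc⟩).symm
  exact (adj v hv rfl).trans (adj w hw hs.symm).symm

variable (c) in
/-- Representatives of pairwise disjoint components, one of each colour. -/
def Triple (u : Fin 3 → V) : Prop :=
  ∀ i j, i ≠ j → ∀ w, c.Linked i w (u i) → ¬ c.Linked j w (u j)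

/-- For each of the colours 1 and 2, `S` meets at most two components, so some component misses `S`.
Two such components cannot share a vertex: an edge from it to `S` would have no colour left. -/
theorem exists_triple_of_single (hP : ¬ c.Partitionable) (hdeg : c.FullDegree) {S : V → Prop}
    (hS : c.Closed 0 S) {s : V} (hs : S s) (h1 : c.Single 1 S) (h2 : c.Single 2 S) :
    ∃ u, c.Triple u := by
  obtain ⟨s', hs'⟩ := hdeg s 0
  have hs'S : S s' := (hS s s' hs').1 hs
  have out : ∀ k, c.Single k S → ∃ u, ∀ w, c.Linked k w u → ¬ S w := by
    intro k hk
    obtain ⟨u, hu1, hu2, -⟩ := exists_not_linked hP k s s' s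
    refine ⟨u, fun w hw hwS => ?_⟩
    by_cases hws : c.side w = c.side s
    · exact hu1 (hw.symm.trans (hk w s hws hwS hs))
    · refine hu2 (hw.symm.trans (hk w s' ?_ hwS hs'S))
      have := hs'.1
      cases h1 : c.side w <;> cases h2 : c.side s <;> cases h3 : c.side s' <;> simp_all
  obtain ⟨u₁, hu1⟩ := out 1 h1
  obtain ⟨u₂, hu2⟩ := out 2 h2
  have h12 : ∀ w, c.Linked 1 w u₁ → ¬ c.Linked 2 w u₂ := by
    intro w hw1 hw2
    obtain ⟨t, hts, ht⟩ : ∃ t, c.side t ≠ c.side w ∧ S t := by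
      by_cases h : c.side s = c.side w
      · exact ⟨s', fun h' => hs'.1 (h.trans h'.symm), hs'S⟩
      · exact ⟨s, h, hs⟩
    have hne := hS.col_ne ht (hu1 w hw1) hts
    have h1' : c.col t w ≠ 1 := fun h => hu1 t (Linked.trans (Step.linked ⟨hts, h⟩) hw1) ht
    have h2' : c.col t w ≠ 2 := fun h => hu2 t (Linked.trans (Step.linked ⟨hts, h⟩) hw2) ht
    generalize c.col t w = x at *
    revert x; decide
  have h01 : ∀ w, c.Linked 0 w s → S w := fun w hw => (hS.linked hw).2 hs
  refine ⟨![s, u₁, u₂], ?_⟩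
  intro i j hij w
  fin_cases i <;> fin_cases j
  · exact absurd rfl hij
  · exact fun h h' => hu1 w h' (h01 w h)
  · exact fun h h' => hu2 w h' (h01 w h)
  · exact fun h h' => hu1 w h (h01 w h')
  · exact absurd rfl hij
  · exact fun h h' => h12 w h h'
  · exact fun h h' => hu2 w h (h01 w h')
  · exact fun h h' => h12 w h' h
  · exact absurd rfl hij

/-- No three vertices satisfying `U` lie in different components of colour `β`. -/
def AtMostTwo (c : BiColoring V) (β : Fin 3) (U : V → Prop) : Prop :=
  ∀ x y z, U x → U y → U z → c.Linked β x y ∨ c.Linked β x z ∨ c.Linked β y z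

theorem twist_cases [Nonempty V] (hP : ¬ c.Partitionable) (hdeg : c.FullDegree)
    {α β : Fin 3} (hαβ : α ≠ β) {S : V → Prop} (hS : c.Closed α S) :
    (∃ b, ∀ y z, c.Twist S y → c.Twist S z → c.side y = b → c.side z = b → c.Linked β y z) ∨
      c.AtMostTwo β (c.Twist S) := by
  obtain ⟨γ, hβγ, hαγ⟩ := exists_third hαβ
  by_contra hcon
  unfold AtMostTwo at hcon
  push Not at hcon
  obtain ⟨h1, x, y, z, h2⟩ := hcon
  refine not_connOn_twist hP hdeg hαγ hS (connOn_twist hαβ hβγ hαγ hS ?_ ⟨x, y, z, h2⟩)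
  intro b
  obtain ⟨y, z, h⟩ := h1 b
  exact ⟨y, z, h⟩

theorem exists_four (hP : ¬ c.Partitionable) (hdeg : c.FullDegree) (k : Fin 3) (b : Bool) (u : V) :
    ∃ x y z : V, c.side x = b ∧ c.side y = b ∧ c.side z = b ∧ ¬ c.Linked k x u ∧
      ¬ c.Linked k y u ∧ ¬ c.Linked k z u ∧ ¬ c.Linked k x y ∧ ¬ c.Linked k x z ∧
      ¬ c.Linked k y z := by
  have key : ∀ u₁ u₂ u₃, ∃ v, c.side v = b ∧ ¬ c.Linked k v u₁ ∧ ¬ c.Linked k v u₂ ∧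
      ¬ c.Linked k v u₃ := by
    intro u₁ u₂ u₃
    obtain ⟨v, h1, h2, h3⟩ := exists_not_linked hP k u₁ u₂ u₃
    obtain ⟨w, hw, hl⟩ := exists_linked_side hdeg k v b
    exact ⟨w, hw, fun h => h1 (hl.trans h), fun h => h2 (hl.trans h), fun h => h3 (hl.trans h)⟩
  obtain ⟨z, hz, hzu, -⟩ := key u u u
  obtain ⟨y, hy, hyu, hyz, -⟩ := key u z z
  obtain ⟨x, hx, hxu, hxy, hxz⟩ := key u y z
  exact ⟨x, y, z, hx, hy, hz, hxu, hyu, hzu, hxy, hxz, hyz⟩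

/-- Apply `twist_cases` to the twist and its complement. Each side meets at least four components of
colour `β`, which excludes the mixed outcomes and forces two one-sided outcomes onto different
sides, where they combine to a `Single` statement. -/
theorem single_cases [Nonempty V] (hP : ¬ c.Partitionable) (hdeg : c.FullDegree)
    {α β : Fin 3} (hαβ : α ≠ β) {S : V → Prop} (hS : c.Closed α S) :
    c.Single β S ∨ c.Single β (fun v => ¬ S v) ∨
      (c.AtMostTwo β (c.Twist S) ∧ c.AtMostTwo β (fun v => ¬ c.Twist S v)) := by
  have h1 := twist_cases hP hdeg hαβ hS
  have h2 := twist_cases hP hdeg hαβ hS.not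
  rw [twist_not] at h2
  -- one half of a side in one component and the other half in at most two is impossible
  have main : ∀ (U : V → Prop) b,
      (∀ y z, U y → U z → c.side y = b → c.side z = b → c.Linked β y z) →
      ¬ c.AtMostTwo β (fun v => ¬ U v) := by
    intro U b hU hA
    by_cases hu : ∃ u, U u ∧ c.side u = b
    · obtain ⟨u, hu, hub⟩ := hu
      obtain ⟨x, y, z, hx, hy, hz, hxu, hyu, hzu, hxy, hxz, hyz⟩ := exists_four hP hdeg β b u
      have := hA x y z (fun h => hxu (hU _ _ h hu hx hub)) (fun h => hyu (hU _ _ h hu hy hub))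
        (fun h => hzu (hU _ _ h hu hz hub))
      tauto
    · push Not at hu
      obtain ⟨x, y, z, hx, hy, hz, hxu, hyu, hzu, hxy, hxz, hyz⟩ :=
        exists_four hP hdeg β b (Classical.arbitrary V)
      have := hA x y z (fun h => hu _ h hx) (fun h => hu _ h hy) (fun h => hu _ h hz)
      tauto
  have weak : ∀ (U : V → Prop) b,
      (∀ y z, U y → U z → c.side y = b → c.side z = b → c.Linked β y z) →
      (∀ y z, ¬ U y → ¬ U z → c.side y = b → c.side z = b → c.Linked β y z) → False := by
    intro U b h1 h2
    obtain ⟨x, y, z, hx, hy, hz, -, -, -, hxy, hxz, hyz⟩ :=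
      exists_four hP hdeg β b (Classical.arbitrary V)
    by_cases hUx : U x <;> by_cases hUy : U y <;> by_cases hUz : U z
    all_goals first
      | exact hxy (h1 _ _ hUx hUy hx hy)
      | exact hxz (h1 _ _ hUx hUz hx hz)
      | exact hyz (h1 _ _ hUy hUz hy hz)
      | exact hxy (h2 _ _ hUx hUy hx hy)
      | exact hxz (h2 _ _ hUx hUz hx hz)
      | exact hyz (h2 _ _ hUy hUz hy hz)
  rcases h1 with ⟨b, hb⟩ | h1
  · rcases h2 with ⟨b', hb'⟩ | h2
    · have hbb : b ≠ b' := by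
        rintro rfl
        exact weak _ _ hb hb'
      cases b
      · obtain rfl : b' = true := by cases b' <;> simp_all
        left
        intro v w hs hv hw
        cases h : c.side v
        · exact hb v w (by simp [Twist, hv, h]) (by simp [Twist, hw, ← hs, h]) h (hs ▸ h)
        · exact hb' v w (by simp [Twist, hv, h]) (by simp [Twist, hw, ← hs, h]) h (hs ▸ h)
      · obtain rfl : b' = false := by cases b' <;> simp_all
        right; left
        intro v w hs hv hw
        cases h : c.side v
        · exact hb' v w (by simp [Twist, hv, h]) (by simp [Twist, hw, ← hs, h]) h (hs ▸ h)
        · exact hb v w (by simp [Twist, hv, h]) (by simp [Twist, hw, ← hs, h]) h (hs ▸ h)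
    · exact absurd h2 (main _ b hb)
  · rcases h2 with ⟨b', hb'⟩ | h2
    · exact absurd (by simpa only [not_not] using h1) (main _ b' hb')
    · exact Or.inr (Or.inr ⟨h1, h2⟩)

/-- Of three components other than that of `x`, two have representatives in the same half. Together
with `x` or `y` that half would meet three components. -/
theorem not_step_of_atMostTwo (hP : ¬ c.Partitionable) {β : Fin 3} {U : V → Prop}
    (h : c.AtMostTwo β U) (h' : c.AtMostTwo β (fun v => ¬ U v)) {x y : V} (hx : U x)
    (hy : ¬ U y) : ¬ c.Step β x y := by
  intro hxy
  have hl := hxy.linked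
  obtain ⟨v₁, h1, -, -⟩ := exists_not_linked hP β x x x
  obtain ⟨v₂, h2, h21, -⟩ := exists_not_linked hP β x v₁ x
  obtain ⟨v₃, h3, h31, h32⟩ := exists_not_linked hP β x v₁ v₂
  have key : ∀ v w, ¬ c.Linked β v x → ¬ c.Linked β w x → ¬ c.Linked β v w →
      (U v ∧ U w) ∨ (¬ U v ∧ ¬ U w) → False := by
    rintro v w hv hw hvw (⟨hv', hw'⟩ | ⟨hv', hw'⟩)
    · rcases h v w x hv' hw' hx with h | h | h
      exacts [hvw h, hv h, hw h]
    · rcases h' v w y hv' hw' hy with h | h | h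
      exacts [hvw h, hv (h.trans hl.symm), hw (h.trans hl.symm)]
  have k1 := key _ _ h2 h1 h21
  have k2 := key _ _ h3 h1 h31
  have k3 := key _ _ h3 h2 h32
  tauto

theorem exists_triple [Nonempty V] (hP : ¬ c.Partitionable) (hdeg : c.FullDegree) :
    ∃ u, c.Triple u := by
  let s : V := Classical.arbitrary V
  have hS : c.Closed 0 (fun v => c.Linked 0 v s) := closed_linked 0 s
  obtain ⟨t, ht, -, -⟩ := exists_not_linked hP 0 s s s
  have d01 : (0 : Fin 3) ≠ 1 := by decide
  have d02 : (0 : Fin 3) ≠ 2 := by decide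
  have d12 : (1 : Fin 3) ≠ 2 := by decide
  have d21 : (2 : Fin 3) ≠ 1 := by decide
  have hs : c.Linked 0 s s := Linked.refl s
  rcases single_cases hP hdeg d01 hS with h | h | h
  · exact exists_triple_of_single hP hdeg hS hs h (h.other hP hdeg d02 d21 d01 hS)
  · exact exists_triple_of_single hP hdeg hS.not ht h (h.other hP hdeg d02 d21 d01 hS.not)
  rcases single_cases hP hdeg d02 hS with h' | h' | h'
  · exact exists_triple_of_single hP hdeg hS hs (h'.other hP hdeg d01 d12 d02 hS) h'
  · exact exists_triple_of_single hP hdeg hS.not ht (h'.other hP hdeg d01 d12 d02 hS.not) h'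
  exfalso
  -- If both other colours are confined to the two twists, all edges within the component of `s` and
  -- within its complement have colour 0. So colour 0 would have only two components.
  have red : ∀ v w, c.side v ≠ c.side w → (c.Linked 0 v s ↔ c.Linked 0 w s) → c.Step 0 v w := by
    intro v w hs hvw
    have hne : ∀ k, (c.AtMostTwo k (c.Twist (fun v => c.Linked 0 v s)) ∧
        c.AtMostTwo k (fun v => ¬ c.Twist (fun v => c.Linked 0 v s) v)) → c.col v w ≠ k := by
      intro k hk hc
      by_cases hv : c.Twist (fun v => c.Linked 0 v s) v
      · refine not_step_of_atMostTwo hP hk.1 hk.2 hv ?_ ⟨hs, hc⟩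
        unfold Twist at hv ⊢
        cases h1 : c.side v <;> cases h2 : c.side w <;> simp_all
      · refine not_step_of_atMostTwo hP hk.1 hk.2 ?_ hv (Step.symm ⟨hs, hc⟩)
        unfold Twist at hv ⊢
        cases h1 : c.side v <;> cases h2 : c.side w <;> simp_all
    exact ⟨hs, Fin.eq_third d12 (by decide) (by decide) (hne 1 h) (hne 2 h')⟩
  obtain ⟨z, hz1, hz2, -⟩ := exists_not_linked hP 0 s t s
  obtain ⟨z', hzs, hz'⟩ := exists_linked_side hdeg 0 z (!c.side t)
  have hz's : ¬ c.Linked 0 z' s := fun h => hz1 (hz'.trans h)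
  have hstep := red z' t (by simp [hzs]) (by simp [hz's, ht])
  exact hz2 (hz'.trans hstep.linked)

end BiColoring

/-! ### Zones and links -/

namespace BiColoring

variable {V : Type*} {c : BiColoring V}

/-- Vertices outside the core `C` become leaves, each hung on a core vertex by one edge of the right
colour. -/
theorem partitionable_of_core (C : V → Prop) (g : V → Fin 3) (κ : Fin 3 → Fin 3)
    (root : Fin 3 → V)
    (hcore : ∀ v, C v → Relation.ReflTransGen
      (fun a b => C a ∧ C b ∧ g a = g b ∧ c.Step (κ (g a)) a b) v (root (g v)))
    (hatt : ∀ v, ¬ C v → ∃ w, C w ∧ c.Step (κ (g w)) v w) : c.Partitionable := by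
  classical
  choose! t ht using hatt
  refine ⟨fun v => if C v then g v else g (t v), κ, root, ?_⟩
  have hC : ∀ v, C v → Relation.ReflTransGen
      (c.PartStep (fun v => if C v then g v else g (t v))
        (κ ∘ fun v => if C v then g v else g (t v))) v (root (g v)) := by
    intro v hv
    refine Relation.ReflTransGen.mono ?_ _ _ (hcore v hv)
    rintro a b ⟨ha, hb, hab, hs⟩
    refine ⟨by simp [ha, hb, hab], ?_⟩
    simpa [ha] using hs
  intro v
  by_cases hv : C v
  · simpa only [if_pos hv] using hC v hv
  · obtain ⟨h1, h2⟩ := ht v hv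
    refine Relation.ReflTransGen.head (b := t v) ⟨by simp [hv, h1], by simpa [hv] using h2⟩ ?_
    simpa only [if_neg hv] using hC _ h1

/-- The vertices whose component of colour `i` avoids the components of `u j` for `j ≠ i`. -/
def Zone (c : BiColoring V) (u : Fin 3 → V) (i : Fin 3) (v : V) : Prop :=
  ∀ j, j ≠ i → ∀ w, c.Linked i w v → ¬ c.Linked j w (u j)

/-- A colouring without a partition, together with representatives of pairwise disjoint
components. -/
structure Critical (c : BiColoring V) (u : Fin 3 → V) : Prop where
  not_partitionable : ¬ c.Partitionable
  full : c.FullDegree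
  triple : c.Triple u

theorem Step.side_eq {k : Fin 3} {v w : V} (h : c.Step k v w) : c.side w = !c.side v := by
  have := h.1
  cases h1 : c.side v <;> cases h2 : c.side w <;> simp_all

theorem closed_zone (u : Fin 3 → V) (i : Fin 3) : c.Closed i (c.Zone u i) := by
  have key : ∀ v w, c.Step i v w → c.Zone u i v → c.Zone u i w :=
    fun v w h hv j hj x hx => hv j hj x (hx.trans h.symm.linked)
  exact fun v w h => ⟨key v w h, key w v h.symm⟩

namespace Critical

variable {u : Fin 3 → V}

theorem zone_self (h : c.Critical u) (i : Fin 3) : c.Zone u i (u i) :=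
  fun j hj w hw => h.triple i j hj.symm w hw

theorem zone_of_linked {i : Fin 3} {v : V} (hv : c.Linked i v (u i)) (h : c.Critical u) :
    c.Zone u i v :=
  ((closed_zone u i).linked hv).2 (h.zone_self i)

theorem exists_zone_side (h : c.Critical u) (i : Fin 3) (b : Bool) :
    ∃ v, c.side v = b ∧ c.Linked i v (u i) := by
  obtain ⟨w, hw, hl⟩ := exists_linked_side h.full i (u i) b
  exact ⟨w, hw, hl.symm⟩

/-- An edge from a common vertex to the chosen component of the third colour `k` cannot have colour
`i` or `j`. So it has colour `k`, which puts the vertex itself in that component. -/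
theorem zone_disjoint (h : c.Critical u) {i j : Fin 3} (hij : i ≠ j) {v : V}
    (hi : c.Zone u i v) (hj : c.Zone u j v) : False := by
  obtain ⟨k, hjk, hik⟩ := exists_third hij
  obtain ⟨w, hw, hl⟩ := h.exists_zone_side k (!c.side v)
  have hs : c.side w ≠ c.side v := by simp [hw]
  have h1 : c.col w v ≠ i := fun hc => hi k hik.symm w (Step.linked ⟨hs, hc⟩) hl
  have h2 : c.col w v ≠ j := fun hc => hj k hjk.symm w (Step.linked ⟨hs, hc⟩) hl
  have h3 : c.col w v = k := Fin.eq_third hij hjk hik h1 h2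
  exact hi k hik.symm v (Linked.refl v) ((Step.linked ⟨hs, h3⟩).symm.trans hl)

theorem col_ne_of_zone {i : Fin 3} {v w : V} (hv : ¬ c.Zone u i v) (hw : c.Zone u i w)
    (hs : c.side v ≠ c.side w) : c.col v w ≠ i :=
  fun hc => hv ((closed_zone u i v w ⟨hs, hc⟩).2 hw)

theorem col_zone_zone (h : c.Critical u) {i j k : Fin 3} (hij : i ≠ j) (hjk : j ≠ k)
    (hik : i ≠ k) {v w : V} (hv : c.Zone u i v) (hw : c.Zone u j w)
    (hs : c.side v ≠ c.side w) : c.Step k v w := by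
  refine ⟨hs, Fin.eq_third hij hjk hik ?_ ?_⟩
  · rw [c.col_comm]
    exact col_ne_of_zone (fun h' => h.zone_disjoint hij h' hw) hv hs.symm
  · exact col_ne_of_zone (fun h' => h.zone_disjoint hij hv h') hw hs

theorem linked_zone_same (h : c.Critical u) {i j : Fin 3} (hij : i ≠ j) {v w : V}
    (hv : c.Zone u j v) (hw : c.Zone u j w) (hs : c.side v = c.side w) : c.Linked i v w := by
  obtain ⟨k, hjk, hik⟩ := exists_third hij
  obtain ⟨x, hx, hxk⟩ := h.exists_zone_side k (!c.side v)
  have hxk := zone_of_linked hxk h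
  exact (h.col_zone_zone hjk hik.symm hij.symm hv hxk (by simp [hx])).linked.trans
    (h.col_zone_zone hjk hik.symm hij.symm hw hxk (by simp [hx, ← hs])).linked.symm

theorem linked_of_not_zone (h : c.Critical u) {i j : Fin 3} (hij : i ≠ j) {v : V}
    (hv : ¬ c.Zone u i v) : ∃ w, c.Zone u j w ∧ c.Linked i v w := by
  unfold Zone at hv
  push Not at hv
  obtain ⟨l, hl, w, hw, hwl⟩ := hv
  have hwl := zone_of_linked hwl h
  by_cases hlj : l = j
  · exact ⟨w, hlj ▸ hwl, hw.symm⟩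
  · obtain ⟨x, hx, hxj⟩ := h.exists_zone_side j (!c.side w)
    have hxj := zone_of_linked hxj h
    exact ⟨x, hxj, hw.symm.trans
      (h.col_zone_zone hlj hij.symm hl hwl hxj (by simp [hx])).linked⟩

/-- All vertices outside zone `i` lie in at most two components of colour `i`, those of `x` and `y`,
one for each side of zone `j`. At least four components exist. -/
theorem exists_two (h : c.Critical u) (i : Fin 3) :
    ∃ v w, c.Zone u i v ∧ c.Zone u i w ∧ ¬ c.Linked i v w := by
  obtain ⟨j, hij⟩ : ∃ j, i ≠ j := ⟨i + 1, by omega⟩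
  obtain ⟨x, hx, hxj⟩ := h.exists_zone_side j false
  obtain ⟨y, hy, hyj⟩ := h.exists_zone_side j true
  have hxj := zone_of_linked hxj h
  have hyj := zone_of_linked hyj h
  have out : ∀ v, ¬ c.Linked i v x → ¬ c.Linked i v y → c.Zone u i v := by
    intro v h1 h2
    by_contra hv
    obtain ⟨w, hw, hvw⟩ := h.linked_of_not_zone hij hv
    cases hs : c.side w
    · exact h1 (hvw.trans (h.linked_zone_same hij hw hxj (hs.trans hx.symm)))
    · exact h2 (hvw.trans (h.linked_zone_same hij hw hyj (hs.trans hy.symm)))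
  obtain ⟨v, h1, h2, -⟩ := exists_not_linked h.not_partitionable i x y x
  obtain ⟨w, h3, h4, h5⟩ := exists_not_linked h.not_partitionable i x y v
  exact ⟨v, w, out v h1 h2, out w h3 h4, fun h' => h5 h'.symm⟩

/-- If two vertices of another zone on different sides are linked in colour `i`, then the zone `i`
has three components. -/
theorem exists_three_of_linked (h : c.Critical u) {i j : Fin 3} (hij : i ≠ j) {x y : V}
    (hx : c.Zone u j x) (hy : c.Zone u j y) (hs : c.side x ≠ c.side y) (hxy : c.Linked i x y)
    (b : Bool) :
    ∃ p q r, c.side p = b ∧ c.side q = b ∧ c.side r = b ∧ c.Zone u i p ∧ c.Zone u i q ∧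
      c.Zone u i r ∧ ¬ c.Linked i p q ∧ ¬ c.Linked i p r ∧ ¬ c.Linked i q r := by
  have out : ∀ v, ¬ c.Linked i v x → c.Zone u i v := by
    intro v h1
    by_contra hv
    obtain ⟨w, hw, hvw⟩ := h.linked_of_not_zone hij hv
    by_cases hws : c.side w = c.side x
    · exact h1 (hvw.trans (h.linked_zone_same hij hw hx hws))
    · refine h1 ((hvw.trans (h.linked_zone_same hij hw hy ?_)).trans hxy.symm)
      cases h1 : c.side w <;> cases h2 : c.side x <;> cases h3 : c.side y <;> simp_all
  obtain ⟨p, q, r, hp, hq, hr, hpx, hqx, hrx, hpq, hpr, hqr⟩ :=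
    exists_four h.not_partitionable h.full i b x
  exact ⟨p, q, r, hp, hq, hr, out p hpx, out q hqx, out r hrx, hpq, hpr, hqr⟩

theorem exists_two_side (h : c.Critical u) (i : Fin 3) (b : Bool) :
    ∃ v w, c.side v = b ∧ c.side w = b ∧ c.Zone u i v ∧ c.Zone u i w ∧ ¬ c.Linked i v w := by
  obtain ⟨v, w, hv, hw, hvw⟩ := h.exists_two i
  obtain ⟨v', hv's, hv'⟩ := exists_linked_side h.full i v b
  obtain ⟨w', hw's, hw'⟩ := exists_linked_side h.full i w b
  exact ⟨v', w', hv's, hw's, ((closed_zone u i).linked hv').1 hv,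
    ((closed_zone u i).linked hw').1 hw, fun h' => hvw ((hv'.trans h').trans hw'.symm)⟩

variable (c u) in
/-- A vertex outside the zones all of whose edges to the zones other than `i` have colour `i`. -/
def IsLink (i : Fin 3) (v : V) : Prop :=
  (∀ l, ¬ c.Zone u l v) ∧ ∀ j, j ≠ i → ∀ w, c.Zone u j w → c.side v ≠ c.side w → c.col v w = i

/-- If no link exists, the zones form a core for a partition to which every outer vertex can be
attached. The edge `xy` serves to connect the part of colour `k`. -/
theorem exists_link (h : c.Critical u) {i j k : Fin 3} (hij : i ≠ j) (hjk : j ≠ k) (hik : i ≠ k)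
    {x y : V} (hx : c.Zone u j x) (hy : c.Zone u j y) (hxy : c.Step k x y) :
    ∃ v, IsLink c u i v := by
  classical
  wlog hxs : c.side x = false generalizing x y
  · exact this hy hx hxy.symm (by rw [hxy.side_eq]; simpa using hxs)
  have hys : c.side y = true := by rw [hxy.side_eq, hxs]; rfl
  by_contra hlink
  push Not at hlink
  apply h.not_partitionable
  choose t t' hts hts' htz htz' htt using h.exists_two_side i
  have htt' : ∀ b, t' b ≠ t b := fun b he => htt b (he ▸ Linked.refl _)
  have hinj : ∀ b b', t b = t b' → b = b' := by
    intro b b' he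
    rw [← hts b, ← hts b', he]
  have dij := fun v => h.zone_disjoint (v := v) hij
  have djk := fun v => h.zone_disjoint (v := v) hjk
  have dik := fun v => h.zone_disjoint (v := v) hik
  -- Part 0, of colour `k`, is zone `j` with zone `i` minus `t false` and `t true`. Parts 1 and 2,
  -- of colour `j`, are the stars from these two vertices to the opposite sides of zone `k`.
  let g : V → Fin 3 := fun v =>
    if c.Zone u j v then 0
    else if c.Zone u k v then (if c.side v = true then 1 else 2)
    else if v = t false then 1 else if v = t true then 2 else 0
  have gj : ∀ v, c.Zone u j v → g v = 0 := fun v hv => by simp [g, hv]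
  have gk : ∀ v, c.Zone u k v → g v = if c.side v = true then 1 else 2 := fun v hv => by
    have : ¬ c.Zone u j v := fun h' => djk v h' hv
    simp [g, hv, this]
  have gi : ∀ v, c.Zone u i v →
      g v = if v = t false then 1 else if v = t true then 2 else 0 := fun v hv => by
    have h1 : ¬ c.Zone u j v := fun h' => dij v hv h'
    have h2 : ¬ c.Zone u k v := fun h' => dik v hv h'
    simp [g, h1, h2]
  have gt : ∀ b, g (t b) = if b = false then 1 else 2 := fun b => by
    rw [gi _ (htz b)]
    cases b
    · simp
    · have : t true ≠ t false := fun he => by simpa using hinj _ _ he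
      simp [this]
  have gi0 : ∀ v, c.Zone u i v → (∀ b, v ≠ t b) → g v = 0 := fun v hv hne => by
    rw [gi v hv]
    simp [hne]
  have gt' : ∀ b, g (t' b) = 0 := fun b => by
    refine gi0 _ (htz' b) fun b' he => ?_
    have : b = b' := by rw [← hts' b, ← hts b', he]
    subst this
    exact htt' b he
  refine partitionable_of_core (fun v => ∃ l, c.Zone u l v) g ![k, j, j]
    ![x, t false, t true] ?_ ?_
  · -- the core
    set R : V → V → Prop := fun a b => (∃ l, c.Zone u l a) ∧ (∃ l, c.Zone u l b) ∧ g a = g b ∧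
      c.Step (![k, j, j] (g a)) a b with hR
    have one : ∀ a b, (∃ l, c.Zone u l a) → (∃ l, c.Zone u l b) → g a = 0 → g b = 0 →
        c.Step k a b → Relation.ReflTransGen R a b := by
      intro a b ha hb hga hgb hab
      refine Relation.ReflTransGen.single ⟨ha, hb, hga.trans hgb.symm, ?_⟩
      rw [hga]; exact hab
    have jz : ∀ v, c.Zone u j v → Relation.ReflTransGen R v x := by
      intro v hv
      have base : ∀ v w, c.Zone u j v → c.Zone u j w → c.side v = c.side w →
          Relation.ReflTransGen R v w := by
        intro v w hv hw hs
        have h1 : c.Step k v (t' (!c.side v)) :=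
          h.col_zone_zone hij.symm hik hjk hv (htz' _) (by simp [hts'])
        have h2 : c.Step k (t' (!c.side v)) w :=
          h.col_zone_zone hij hjk hik (htz' _) hw (by simp [hts', hs])
        exact (one _ _ ⟨j, hv⟩ ⟨i, htz' _⟩ (gj v hv) (gt' _) h1).trans
          (one _ _ ⟨i, htz' _⟩ ⟨j, hw⟩ (gt' _) (gj w hw) h2)
      by_cases hs : c.side v = false
      · exact base v x hv hx (hs.trans hxs.symm)
      · exact (base v y hv hy (by simpa [hys] using hs)).trans
          (one _ _ ⟨j, hy⟩ ⟨j, hx⟩ (gj y hy) (gj x hx) hxy.symm)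
    have star : ∀ v, c.Zone u k v → Relation.ReflTransGen R v (t (!c.side v)) := by
      intro v hv
      refine Relation.ReflTransGen.single ⟨⟨k, hv⟩, ⟨i, htz _⟩, ?_, ?_⟩
      · rw [gk v hv, gt]
        cases c.side v <;> simp
      · have : (![k, j, j] : Fin 3 → Fin 3) (g v) = j := by
          rw [gk v hv]; split_ifs <;> rfl
        rw [this]
        exact h.col_zone_zone hik.symm hij hjk.symm hv (htz _) (by simp [hts])
    rintro v ⟨l, hl⟩
    by_cases hlj : l = j
    · subst hlj
      rw [gj v hl]
      exact jz v hl
    by_cases hlk : l = k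
    · subst hlk
      have h1 := star v hl
      rw [gk v hl]
      cases hs : c.side v
      · simpa [hs] using h1
      · simpa [hs] using h1
    have hli : l = i := Fin.eq_third hjk hik.symm hij.symm hlj hlk
    subst hli
    by_cases hv : ∃ b, v = t b
    · obtain ⟨b, rfl⟩ := hv
      rw [gt]
      cases b <;> exact Relation.ReflTransGen.refl
    · push Not at hv
      rw [gi0 v hl hv]
      obtain ⟨z, hz, hzj⟩ := h.exists_zone_side j (!c.side v)
      have hzj := zone_of_linked hzj h
      exact (one _ _ ⟨l, hl⟩ ⟨j, hzj⟩ (gi0 v hl hv) (gj z hzj)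
        (h.col_zone_zone hij hjk hik hl hzj (by simp [hz]))).trans (jz z hzj)
  · intro v hv
    push Not at hv
    by_contra hcon
    push Not at hcon
    refine hlink v ⟨hv, ?_⟩
    have hj : ∀ w, c.Zone u j w → c.side v ≠ c.side w → c.col v w = i := by
      intro w hw hs
      have h1 : c.col v w ≠ j := col_ne_of_zone (hv j) hw hs
      have h2 : c.col v w ≠ k := fun hc => hcon w ⟨j, hw⟩ (by rw [gj w hw]; exact ⟨hs, hc⟩)
      exact Fin.eq_third hjk hik.symm hij.symm h1 h2
    have ht : c.col v (t (!c.side v)) ≠ j := by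
      intro hc
      refine hcon _ ⟨i, htz (!c.side v)⟩ ?_
      have : (![k, j, j] : Fin 3 → Fin 3) (g (t (!c.side v))) = j := by
        rw [gt]; split_ifs <;> rfl
      rw [this]
      exact ⟨by simp [hts], hc⟩
    have hk : ∀ w, c.Zone u k w → c.side v ≠ c.side w → c.col v w = i := by
      intro w hw hs
      have h1 : c.col v w ≠ k := col_ne_of_zone (hv k) hw hs
      have h2 : c.col v w ≠ j := fun hc => hcon w ⟨k, hw⟩ (by
        have : (![k, j, j] : Fin 3 → Fin 3) (g w) = j := by
          rw [gk w hw]; split_ifs <;> rfl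
        rw [this]; exact ⟨hs, hc⟩)
      exact Fin.eq_third hjk hik.symm hij.symm h2 h1
    intro l hl w hw hs
    by_cases hlj : l = j
    · exact hj w (hlj ▸ hw) hs
    · have hlk : l = k := Fin.eq_third hij hjk hik hl hlj
      exact hk w (hlk ▸ hw) hs

/-- For every colour `i` there is a link, or the edges inside the other zones avoid the third
colour. -/
theorem link_or (h : c.Critical u) (i : Fin 3) :
    (∃ v, IsLink c u i v) ∨ ∀ j, j ≠ i → ∀ x y, c.Zone u j x → c.Zone u j y →
      c.side x ≠ c.side y → c.col x y = i ∨ c.col x y = j := by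
  by_contra hcon
  push Not at hcon
  obtain ⟨h1, j, hj, x, y, hx, hy, hs, hi, hj'⟩ := hcon
  obtain ⟨k, hjk, hik⟩ := exists_third hj.symm
  have hk : c.col x y = k := Fin.eq_third hj.symm hjk hik hi hj'
  obtain ⟨v, hv⟩ := h.exists_link hj.symm hjk hik hx hy ⟨hs, hk⟩
  exact h1 v hv

theorem exists_three (h : c.Critical u) (i : Fin 3) (b : Bool) :
    ∃ p q r, c.side p = b ∧ c.side q = b ∧ c.side r = b ∧ c.Zone u i p ∧ c.Zone u i q ∧
      c.Zone u i r ∧ ¬ c.Linked i p q ∧ ¬ c.Linked i p r ∧ ¬ c.Linked i q r := by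
  obtain ⟨j, hij⟩ : ∃ j, i ≠ j := ⟨i + 1, by omega⟩
  obtain ⟨k, hjk, hik⟩ := exists_third hij
  suffices ∃ x y, c.Zone u j x ∧ c.Zone u j y ∧ c.side x ≠ c.side y ∧ c.Linked i x y by
    obtain ⟨x, y, hx, hy, hs, hxy⟩ := this
    exact h.exists_three_of_linked hij hx hy hs hxy b
  -- A link of colour `i` connects zones `j` and `k` on one side, and an edge between these zones
  -- then reaches the other side of zone `j`. Without a link, an edge of zone `j` between different
  -- components of colour `j` must have colour `i`.
  rcases h.link_or i with ⟨v, hv, hlink⟩ | hfree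
  · obtain ⟨x, hxs, hx⟩ := h.exists_zone_side j (!c.side v)
    obtain ⟨y, hys, hy⟩ := h.exists_zone_side k (!c.side v)
    obtain ⟨z, hzs, hz⟩ := h.exists_zone_side j (c.side v)
    have hx := zone_of_linked hx h
    have hy := zone_of_linked hy h
    have hz := zone_of_linked hz h
    have h1 : c.Step i v x := ⟨by simp [hxs], hlink j hij.symm x hx (by simp [hxs])⟩
    have h2 : c.Step i v y := ⟨by simp [hys], hlink k hik.symm y hy (by simp [hys])⟩
    have h3 : c.Step i z y := h.col_zone_zone hjk hik.symm hij.symm hz hy (by simp [hzs, hys])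
    exact ⟨x, z, hx, hz, by simp [hxs, hzs],
      (h1.symm.linked.trans h2.linked).trans h3.symm.linked⟩
  · obtain ⟨x, y, hxs, hys, hx, hy, hxy⟩ := h.exists_two_side j false
    obtain ⟨z, hz⟩ := h.full x j
    have hzz := (closed_zone u j x z hz).1 hx
    have hs : c.side y ≠ c.side z := by rw [hys, ← hxs]; exact hz.1
    have h1 : c.col y z ≠ j := fun hc => hxy (hz.linked.trans (Step.linked ⟨hs, hc⟩).symm)
    have h2 := (hfree j hij.symm y z hy hzz hs).resolve_right h1
    exact ⟨y, z, hy, hzz, hs, Step.linked ⟨hs, h2⟩⟩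

end Critical

end BiColoring

/-! ### Menus: attaching outer vertices to the skeleton -/

namespace BiColoring

variable {V : Type*} {c : BiColoring V} {u : Fin 3 → V}

variable (c u) in
/-- `v` lies outside all zones. -/
def Outer (v : V) : Prop := ∀ l, ¬ c.Zone u l v

variable (c u) in
/-- With `s i` as the chosen vertex of zone `i` on the side opposite to `x`, the vertex `x` can be
attached to the part of colour `k`. -/
def Avail (s : Fin 3 → V) (x : V) (k : Fin 3) : Prop :=
  c.Step k x (s (k + 2)) ∨ ∃ y, c.Zone u (k + 1) y ∧ y ≠ s (k + 1) ∧ c.Step k x y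

variable (c u) in
/-- A choice of one vertex on the side `b` in each zone. -/
def IsMenu (b : Bool) (s : Fin 3 → V) : Prop := ∀ i, c.Zone u i (s i) ∧ c.side (s i) = b

variable (c u) in
/-- `y` is a vertex of zone `i` joined to `x` by an edge of colour `i + 2`. -/
def Hot (x : V) (i : Fin 3) (y : V) : Prop := c.Zone u i y ∧ c.Step (i + 2) x y

variable {x : V} {s : Fin 3 → V}

theorem avail_of_hot {i : Fin 3} {y : V} (hy : Hot c u x i y) (hne : y ≠ s i) :
    Avail c u s x (i + 2) := by
  have e : i + 2 + 1 = i := by omega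
  right
  rw [e]
  exact ⟨y, hy.1, hne, hy.2⟩

theorem avail_of_not_hot {b : Bool} (hs : IsMenu c u (!b) s) (hx : Outer c u x)
    (hb : c.side x = b) {i : Fin 3} (hi : ¬ Hot c u x i (s i)) : Avail c u s x (i + 1) := by
  have e : i + 1 + 2 = i := by omega
  left
  rw [e]
  have hne : c.side x ≠ c.side (s i) := by simp [hb, (hs i).2]
  refine ⟨hne, Fin.eq_third (a := i) (b := i + 2) (by omega) (by omega) (by omega)
    (Critical.col_ne_of_zone (hx i) (hs i).1 hne) fun hc => hi ⟨(hs i).1, hne, hc⟩⟩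

/-- An outer vertex sees zone `i` only in colours `i + 1` and `i + 2`. Being killed means that each
zone has exactly one hot vertex and the menu chooses it. Hence a vertex determines the menu that can
kill it. -/
theorem hot_of_killed {b : Bool} (hs : IsMenu c u (!b) s) (hx : Outer c u x)
    (hb : c.side x = b) (hK : ∀ k, ¬ Avail c u s x k) (i : Fin 3) :
    Hot c u x i (s i) ∧ ∀ y, Hot c u x i y → y = s i := by
  constructor
  · by_contra h
    exact hK _ (avail_of_not_hot hs hx hb h)
  · intro y hy
    by_contra h
    exact hK _ (avail_of_hot hy h)

theorem exists_of_avail {k : Fin 3} (h : Avail c u s x k) :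
    ∃ i, ¬ Hot c u x i (s i) ∨ ∃ y, Hot c u x i y ∧ y ≠ s i := by
  rcases h with h | ⟨y, hy, hne, hs⟩
  · refine ⟨k + 2, Or.inl fun h' => ?_⟩
    have h1 := h'.2.2
    rw [h.2] at h1
    omega
  · have e : k + 1 + 2 = k := by omega
    exact ⟨k + 1, Or.inr ⟨y, ⟨hy, by rwa [e]⟩, hne⟩⟩

theorem avail_of_killed {b : Bool} {s' : Fin 3 → V} (hs : IsMenu c u (!b) s)
    (hx : Outer c u x) (hb : c.side x = b)
    (hK : ∀ k, ¬ Avail c u s x k) (hne : ∀ i, s i ≠ s' i) (k : Fin 3) : Avail c u s' x k := by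
  have h := (hot_of_killed hs hx hb hK (k + 1)).1
  have e : k + 1 + 2 = k := by omega
  have := avail_of_hot (s := s') h (hne _)
  rwa [e] at this

theorem eq_of_killed {b : Bool} {s' : Fin 3 → V} (hs : IsMenu c u (!b) s)
    (hs' : IsMenu c u (!b) s') (hx : Outer c u x) (hb : c.side x = b)
    (hK : ∀ k, ¬ Avail c u s x k) (hK' : ∀ k, ¬ Avail c u s' x k) : s = s' := by
  funext i
  exact (hot_of_killed hs' hx hb hK' i).2 _ (hot_of_killed hs hx hb hK i).1

/-- If three disjoint menus do not kill `x`, they offer a common colour. -/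
theorem exists_common_avail {b : Bool} {s : Fin 3 → Fin 3 → V}
    (hs : ∀ m, IsMenu c u (!b) (s m)) (hne : ∀ m m', m ≠ m' → ∀ i, s m i ≠ s m' i)
    (hx : Outer c u x) (hb : c.side x = b) (hK : ∀ m, ∃ k, Avail c u (s m) x k) :
    ∃ k, ∀ m, Avail c u (s m) x k := by
  by_cases h0 : ∃ i, ∀ y, ¬ Hot c u x i y
  · obtain ⟨i, hi⟩ := h0
    exact ⟨i + 1, fun m => avail_of_not_hot (hs m) hx hb (hi _)⟩
  push Not at h0
  choose p hp using h0
  by_cases h2 : ∃ i y, Hot c u x i y ∧ y ≠ p i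
  · obtain ⟨i, y, hy, hyp⟩ := h2
    refine ⟨i + 2, fun m => ?_⟩
    by_cases h : y = s m i
    · exact avail_of_hot (hp i) fun h' => hyp (h.trans h'.symm)
    · exact avail_of_hot hy h
  push Not at h2
  have key : ∀ m i, s m i ≠ p i → Avail c u (s m) x (i + 1) ∧ Avail c u (s m) x (i + 2) :=
    fun m i h => ⟨avail_of_not_hot (hs m) hx hb fun h' => h (h2 _ _ h'),
      avail_of_hot (hp i) h.symm⟩
  have notall : ∀ m, ∃ i, s m i ≠ p i := by
    intro m
    obtain ⟨k, hk⟩ := hK m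
    obtain ⟨i, hi | ⟨y, hy, hyi⟩⟩ := exists_of_avail hk
    · exact ⟨i, fun h => hi (h ▸ hp i)⟩
    · exact ⟨i, fun h => hyi (h ▸ h2 _ _ hy)⟩
  have uniq : ∀ m m' i, s m i = p i → s m' i = p i → m = m' := by
    intro m m' i h h'
    by_contra hmm
    exact hne m m' hmm i (h.trans h'.symm)
  have e1 : ∀ i : Fin 3, i + 1 + 1 = i + 2 := by decide
  have e2 : ∀ i : Fin 3, i + 1 + 2 = i := by decide
  have e3 : ∀ i : Fin 3, i + 2 + 1 = i := by decide
  -- Each zone now has a single hot vertex `p i`, chosen by at most one menu, and a menu missing `p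
  -- i` offers `i + 1` and `i + 2`. If some menu contains `p i` and `p (i + 1)`, it misses `p (i +
  -- 2)` and the others miss `p (i + 1)`, so all offer `i`. Otherwise every menu misses `p 0` or `p
  -- 1` and offers 2.
  by_cases hbad : ∃ m i, s m i = p i ∧ s m (i + 1) = p (i + 1)
  · obtain ⟨m, i, h1, h2⟩ := hbad
    have h3 : s m (i + 2) ≠ p (i + 2) := by
      intro h3
      obtain ⟨j, hj⟩ := notall m
      have : j = i ∨ j = i + 1 ∨ j = i + 2 := by
        clear * -
        omega
      rcases this with rfl | rfl | rfl
      exacts [hj h1, hj h2, hj h3]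
    refine ⟨i, fun m' => ?_⟩
    by_cases hm : m' = m
    · have := (key m (i + 2) h3).1
      rw [e3] at this
      exact hm ▸ this
    · have h4 : s m' (i + 1) ≠ p (i + 1) := fun h => hm (uniq _ _ _ h h2)
      have := (key m' _ h4).2
      rwa [e2] at this
  · push Not at hbad
    refine ⟨2, fun m => ?_⟩
    by_cases h : s m 0 = p 0
    · exact (key m 1 (hbad m 0 h)).1
    · exact (key m 0 h).2

theorem IsLink.avail {b : Bool} (hs : IsMenu c u (!b) s) {i : Fin 3} (hb : c.side x = b)
    (hv : Critical.IsLink c u i x) : Avail c u s x i := by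
  left
  have hne : c.side x ≠ c.side (s (i + 2)) := by simp [hb, (hs _).2]
  exact ⟨hne, hv.2 (i + 2) (by omega) _ (hs _).1 hne⟩

theorem IsLink.unique (h : c.Critical u) {i j : Fin 3} (hi : Critical.IsLink c u i x)
    (hj : Critical.IsLink c u j x) : i = j := by
  obtain ⟨k, hik, hjk⟩ : ∃ k, k ≠ i ∧ k ≠ j := by
    clear * -
    revert i j
    decide
  obtain ⟨w, hw, hwk⟩ := h.exists_zone_side k (!c.side x)
  have hwk := Critical.zone_of_linked hwk h
  rw [← hi.2 k hik w hwk (by simp [hw]), hj.2 k hjk w hwk (by simp [hw])]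

/-- A choice of colours for the outer vertices extends to a partition of the whole graph. -/
theorem Critical.partitionable_of_outer (h : c.Critical u) (s : Bool → Fin 3 → V)
    (hs : ∀ b, IsMenu c u b (s b)) (F : V → Fin 3)
    (hlink : ∀ i, (∃ v, IsLink c u i v ∧ F v = i) ∨ ∀ v, ¬ IsLink c u i v)
    (hatt : ∀ v, Outer c u v → ∃ w, Outer c u w ∧ Relation.ReflTransGen
      (fun a b => Outer c u a ∧ Outer c u b ∧ F a = F b ∧ c.Step (F a) a b) v w ∧
      Avail c u (s (!c.side w)) w (F w)) : c.Partitionable := by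
  classical
  -- In zone `i` the chosen vertices join part `i + 1` as star centres, the others join part `i + 2`
  -- as leaves.
  let g : V → Fin 3 := fun v =>
    if c.Zone u 0 v then (if v = s (c.side v) 0 then 1 else 2)
    else if c.Zone u 1 v then (if v = s (c.side v) 1 then 2 else 0)
    else if c.Zone u 2 v then (if v = s (c.side v) 2 then 0 else 1)
    else F v
  have g0 : ∀ v, Outer c u v → g v = F v := fun v hv => by simp [g, hv 0, hv 1, hv 2]
  have gz : ∀ i v, c.Zone u i v → g v = if v = s (c.side v) i then i + 1 else i + 2 := by
    intro i v hv
    have hn : ∀ j, j ≠ i → ¬ c.Zone u j v := fun j hj hj' => h.zone_disjoint hj hj' hv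
    fin_cases i
    · have : c.Zone u 0 v := hv
      simp [g, this]
    · have h1 : c.Zone u 1 v := hv
      have h2 := hn 0 (by decide)
      simp [g, h1, h2]
    · have h1 : c.Zone u 2 v := hv
      have h2 := hn 0 (by decide)
      have h3 := hn 1 (by decide)
      simp [g, h1, h2, h3]
  have gs : ∀ b k, g (s b (k + 2)) = k := by
    intro b k
    rw [gz _ _ (hs b _).1, (hs b _).2, if_pos rfl]
    omega
  have gn : ∀ k v, c.Zone u (k + 1) v → v ≠ s (c.side v) (k + 1) → g v = k := by
    intro k v hv hne
    rw [gz _ _ hv, if_neg hne]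
    omega
  have d12 : ∀ k : Fin 3, k + 1 ≠ k + 2 := by decide
  have d1 : ∀ k : Fin 3, k + 1 ≠ k := by decide
  have d2 : ∀ k : Fin 3, k + 2 ≠ k := by decide
  refine ⟨g, id, fun k => s false (k + 2), ?_⟩
  set R := c.PartStep g (id ∘ g) with hR
  have hsymm : ∀ v w, Relation.ReflTransGen R v w → Relation.ReflTransGen R w v := by
    intro v w hvw
    induction hvw with
    | refl => exact Relation.ReflTransGen.refl
    | tail _ h ih => exact Relation.ReflTransGen.head (PartStep.symm h) ih
  have one : ∀ k a b, g a = k → g b = k → c.Step k a b → Relation.ReflTransGen R a b := by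
    rintro k a b rfl hb hab
    exact Relation.ReflTransGen.single ⟨hb.symm, hab⟩
  have leaf : ∀ k v, c.Zone u (k + 1) v → v ≠ s (c.side v) (k + 1) →
      Relation.ReflTransGen R v (s (!c.side v) (k + 2)) := by
    intro k v hv hne
    exact one k _ _ (gn k v hv hne) (gs _ _)
      (h.col_zone_zone (d12 k) (d2 k) (d1 k) hv (hs _ _).1 (by simp [(hs _ _).2]))
  have other : ∀ k b, ∃ y, c.side y = b ∧ c.Zone u (k + 1) y ∧ y ≠ s b (k + 1) := by
    intro k b
    obtain ⟨v, w, hv, hw, hvz, hwz, hvw⟩ := h.exists_two_side (k + 1) b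
    by_cases hvs : v = s b (k + 1)
    · exact ⟨w, hw, hwz, fun hws => hvw (hvs.trans hws.symm ▸ Linked.refl _)⟩
    · exact ⟨v, hv, hvz, hvs⟩
  -- The two stars of part `k` are joined by a link, if there is one. Otherwise edges within zone `k
  -- + 1` have colour `k` or `k + 1`, and the three components of colour `k + 1` leave an edge of
  -- colour `k` between two leaves.
  have center : ∀ k b, Relation.ReflTransGen R (s b (k + 2)) (s (!b) (k + 2)) := by
    intro k b
    suffices ∃ b, Relation.ReflTransGen R (s b (k + 2)) (s (!b) (k + 2)) by
      obtain ⟨b', hb'⟩ := this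
      by_cases hbb : b = b'
      · exact hbb ▸ hb'
      · obtain rfl : b = !b' := Bool.eq_not_of_ne hbb
        simpa using hsymm _ _ hb'
    rcases hlink k with ⟨v, hv, hF⟩ | hno
    · obtain ⟨y, hys, hyz, hyne⟩ := other k (!c.side v)
      have hgv : g v = k := (g0 v hv.1).trans hF
      have hgy : g y = k := gn k y hyz (by rwa [hys])
      have h1 := leaf k y hyz (by rwa [hys])
      rw [hys, Bool.not_not] at h1
      have h2 : Relation.ReflTransGen R v y :=
        one k _ _ hgv hgy ⟨by simp [hys], hv.2 _ (d1 k) y hyz (by simp [hys])⟩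
      have h3 : Relation.ReflTransGen R v (s (!c.side v) (k + 2)) :=
        one k _ _ hgv (gs _ _) ⟨by simp [(hs _ _).2],
          hv.2 _ (d2 k) _ (hs _ _).1 (by simp [(hs _ _).2])⟩
      exact ⟨c.side v, ((hsymm _ _ h1).trans (hsymm _ _ h2)).trans h3⟩
    · have hfree := (h.link_or k).resolve_left (fun ⟨v, hv⟩ => hno v hv) (k + 1) (d1 k)
      obtain ⟨y, hys, hyz, hyne⟩ := other k false
      obtain ⟨p, q, r, hp, hq, hr, hpz, hqz, hrz, hpq, hpr, hqr⟩ := h.exists_three (k + 1) true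
      obtain ⟨z, hzs, hzz, hzne, hyz'⟩ : ∃ z, c.side z = true ∧ c.Zone u (k + 1) z ∧
          z ≠ s true (k + 1) ∧ ¬ c.Linked (k + 1) y z := by
        have k1 : ∀ a b, ¬ c.Linked (k + 1) a b → c.Linked (k + 1) y a →
            ¬ c.Linked (k + 1) y b := fun a b hab ha hb => hab (ha.symm.trans hb)
        have k2 : ∀ a b, ¬ c.Linked (k + 1) a b → a = s true (k + 1) → b ≠ s true (k + 1) :=
          fun a b hab ha hb => hab (ha.trans hb.symm ▸ Linked.refl _)
        by_contra hcon
        push Not at hcon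
        have a1 := hcon p hp hpz
        have a2 := hcon q hq hqz
        have a3 := hcon r hr hrz
        have b1 := k1 _ _ hpq
        have b2 := k1 _ _ hpr
        have b3 := k1 _ _ hqr
        have c1 := k2 _ _ hpq
        have c2 := k2 _ _ hpr
        have c3 := k2 _ _ hqr
        tauto
      have hne : c.side y ≠ c.side z := by simp [hys, hzs]
      have hcol : c.col y z = k := (hfree y z hyz hzz hne).resolve_right
        fun hc => hyz' (Step.linked ⟨hne, hc⟩)
      have h1 := leaf k y hyz (by rwa [hys])
      have h2 := leaf k z hzz (by rwa [hzs])
      rw [hys] at h1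
      rw [hzs] at h2
      refine ⟨true, ((hsymm _ _ h1).trans ?_).trans h2⟩
      exact one k _ _ (gn k y hyz (by rwa [hys])) (gn k z hzz (by rwa [hzs])) ⟨hne, hcol⟩
  have toRoot : ∀ k b, Relation.ReflTransGen R (s b (k + 2)) (s false (k + 2)) := by
    intro k b
    cases b
    · exact Relation.ReflTransGen.refl
    · exact center k true
  have avail : ∀ v, Outer c u v → Avail c u (s (!c.side v)) v (F v) →
      Relation.ReflTransGen R v (s false (F v + 2)) := by
    rintro v hv (hA | ⟨y, hyz, hyne, hvy⟩)
    · exact (one _ _ _ (g0 v hv) (gs _ _) hA).trans (toRoot _ _)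
    · have hys := hvy.side_eq
      rw [← hys] at hyne
      exact ((one _ _ _ (g0 v hv) (gn _ y hyz hyne) hvy).trans (leaf _ y hyz hyne)).trans
        (toRoot _ _)
  intro v
  by_cases hv : Outer c u v
  · obtain ⟨w, hw, hvw, hA⟩ := hatt v hv
    rw [g0 v hv]
    have hF : F v = F w := by
      clear hA hw
      induction hvw with
      | refl => rfl
      | tail _ h ih => exact ih.trans h.2.2.1
    rw [hF]
    refine Relation.ReflTransGen.trans ?_ (avail w hw hA)
    refine Relation.ReflTransGen.mono ?_ _ _ hvw
    rintro a b ⟨ha, hb, hab, hst⟩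
    refine ⟨by rw [g0 a ha, g0 b hb, hab], ?_⟩
    simpa [g0 a ha] using hst
  · unfold Outer at hv
    push Not at hv
    obtain ⟨i, hi⟩ := hv
    by_cases hsv : v = s (c.side v) i
    · obtain ⟨k, rfl⟩ : ∃ k, i = k + 2 := ⟨i + 1, by omega⟩
      rw [hsv, gs]
      exact toRoot _ _
    · obtain ⟨k, rfl⟩ : ∃ k, i = k + 1 := ⟨i + 2, by omega⟩
      rw [gn k v hi hsv]
      exact (leaf k v hi hsv).trans (toRoot _ _)

end BiColoring

/-! ### Rescuing killed vertices -/

theorem Finset.exists_injOn_of_card_le {V : Type*} [DecidableEq V] (K Z : Finset V)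
    (R : V → V → Prop) [∀ x, DecidablePred (R x)]
    (h : ∀ x ∈ K, K.card ≤ (Z.filter (R x)).card) :
    ∃ q : V → V, (∀ x ∈ K, ∀ y ∈ K, q x = q y → x = y) ∧ ∀ x ∈ K, q x ∈ Z ∧ R x (q x) := by
  have hall := (Finset.all_card_le_biUnion_card_iff_exists_injective
    (fun x : K => Z.filter (R x))).1 ?_
  · obtain ⟨f, hf, hfm⟩ := hall
    refine ⟨fun x => if hx : x ∈ K then f ⟨x, hx⟩ else x, ?_, ?_⟩
    · intro x hx y hy hxy
      simp only [dif_pos hx, dif_pos hy] at hxy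
      exact congrArg Subtype.val (hf hxy)
    · intro x hx
      simp only [dif_pos hx]
      exact Finset.mem_filter.1 (hfm ⟨x, hx⟩)
  · intro S
    rcases S.eq_empty_or_nonempty with rfl | ⟨x, hx⟩
    · simp
    · calc S.card ≤ K.card := by
            simpa using Finset.card_le_univ S
        _ ≤ (Z.filter (R x)).card := h x x.2
        _ ≤ _ := Finset.card_le_card (Finset.subset_biUnion_of_mem
            (fun x : K => Z.filter (R x)) hx)

/-- A popular value of a colouring with values in a set of `t` colours. -/
theorem Finset.exists_popular {V : Type*} (Z : Finset V) (f : V → Fin 3) (D : Finset (Fin 3))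
    (hf : ∀ y ∈ Z, f y ∈ D) (n : ℕ) (hn : D.card * n < Z.card) :
    ∃ g ∈ D, n ≤ (Z.filter (fun y => f y = g)).card := by
  obtain ⟨g, hg, hlt⟩ := Finset.exists_lt_card_fiber_of_mul_lt_card_of_maps_to hf hn
  exact ⟨g, hg, hlt.le⟩

section Rescue

variable {V : Type*} (col : V → V → Fin 3) (A : Fin 3 → V → Fin 3 → Prop)
  (P : V → Fin 3 → Prop) (K : Fin 3 → Finset V) (Y : Finset V)

/-- The vertices killed by the menus can be coloured under the menu `m` with the help of a set
`Q ⊆ Y` of rescuing vertices, coloured by `H`. -/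
def Rescuable : Prop :=
  ∃ (m : Fin 3) (F H : V → Fin 3) (Q : Finset V), Q ⊆ Y ∧
    (∀ l, ∀ x ∈ K l, A m x (F x) ∨ ∃ y ∈ Q, F x = H y ∧ col x y = H y) ∧
    ∀ y ∈ Q, P y (H y) ∨ ∃ l, ∃ x ∈ K l, A m x (F x) ∧ F x = H y ∧ col x y = H y

variable {col A P K Y}

/-- Distinct rescuers for distinct vertices of `K m` make the rescuers' colours consistent. Vertices
of the other `K l` may take any colour under menu `m`, so `F₀` is free there and they can support
rescuers. -/
theorem rescuable_of_injOn [DecidableEq V] (hA : ∀ m, ∀ x ∈ K m, ∀ m', m' ≠ m → ∀ k, A m' x k)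
    (m : Fin 3) (F₀ : V → Fin 3) (q : V → V)
    (hq : ∀ x ∈ K m, ∀ y ∈ K m, q x = q y → x = y) (hqY : ∀ x ∈ K m, q x ∈ Y)
    (hqP : ∀ x ∈ K m, P (q x) (col x (q x)) ∨
      ∃ l, ∃ z ∈ K l, l ≠ m ∧ z ∉ K m ∧ F₀ z = col x (q x) ∧ col z (q x) = col x (q x)) :
    Rescuable col A P K Y := by
  classical
  refine ⟨m, fun x => if x ∈ K m then col x (q x) else F₀ x,
    fun y => if h : ∃ x ∈ K m, q x = y then col h.choose y else 0, (K m).image q, ?_, ?_, ?_⟩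
  · exact Finset.image_subset_iff.2 hqY
  all_goals
    have hH : ∀ x ∈ K m, (if h : ∃ z ∈ K m, q z = q x then col h.choose (q x) else 0) =
        col x (q x) := by
      intro x hx
      have h : ∃ z ∈ K m, q z = q x := ⟨x, hx, rfl⟩
      rw [dif_pos h, hq _ h.choose_spec.1 _ hx h.choose_spec.2]
  · intro l x hx
    by_cases hm : x ∈ K m
    · right
      refine ⟨q x, Finset.mem_image_of_mem _ hm, ?_⟩
      simp only [hH x hm, if_pos hm, and_self]
    · left
      refine hA l x hx m ?_ _
      rintro rfl
      exact hm hx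
  · intro y hy
    obtain ⟨x, hx, rfl⟩ := Finset.mem_image.1 hy
    simp only [hH x hx]
    refine (hqP x hx).imp_right ?_
    rintro ⟨l, z, hz, hlm, hzm, h1, h2⟩
    refine ⟨l, z, hz, hA l z hz m hlm.symm _, ?_, h2⟩
    rw [if_neg hzm, h1]

/-- Try menus 0, 1, 2 in turn. A failure at menu `m` produces a killed vertex joined in one colour
to many rescuers that do not have that colour themselves. Under later menus this vertex is unkilled
and supports that colour. After two failures every colour is supported. -/
theorem rescuable_of_card [DecidableEq V]
    (hA : ∀ m, ∀ x ∈ K m, ∀ m', m' ≠ m → ∀ k, A m' x k)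
    (hK : ∀ m, ∀ x ∈ K m, ∀ k, ¬ A m x k)
    (hP : ∀ y ∈ Y, ∃ k, P y k)
    (hcard : (K 0).card + 3 * (K 1).card + 6 * (K 2).card ≤ Y.card) :
    Rescuable col A P K Y := by
  classical
  have hdis : ∀ m m', m ≠ m' → ∀ x, x ∈ K m → x ∉ K m' := fun m m' hm x hx hx' =>
    hK m' x hx' 0 (hA m x hx m' hm.symm 0)
  -- a vertex with few candidates has many non-candidates
  have few : ∀ (Z : Finset V) (R : V → Prop) [DecidablePred R] (n : ℕ), (Z.filter R).card < n →
      Z.card < n + (Z.filter (fun y => ¬ R y)).card := by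
    intro Z R _ n hn
    have := Finset.card_filter_add_card_filter_not (s := Z) R
    omega
  by_cases h0 : ∀ x ∈ K 0, (K 0).card ≤ (Y.filter fun y => P y (col x y)).card
  · obtain ⟨q, hq, hq'⟩ := Finset.exists_injOn_of_card_le (K 0) Y _ h0
    exact rescuable_of_injOn hA 0 (fun _ => 0) q hq (fun x hx => (hq' x hx).1)
      fun x hx => Or.inl (hq' x hx).2
  push Not at h0
  obtain ⟨x₀, hx₀, hlt₀⟩ := h0
  have hmany₀ := few _ _ _ hlt₀
  -- Removing fewer than `|K 0|` good candidates leaves more than `3 * (|K 1| + 2 * |K 2|)`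
  -- vertices, whence the weights 1, 3, 6: three colours compete here, two in the next round.
  obtain ⟨g₁, -, hg₁⟩ := Finset.exists_popular (Y.filter fun y => ¬ P y (col x₀ y)) (col x₀)
    Finset.univ (fun _ _ => Finset.mem_univ _) ((K 1).card + 2 * (K 2).card)
    (by simp only [Finset.card_univ, Fintype.card_fin]; omega)
  set Z₁ := (Y.filter fun y => ¬ P y (col x₀ y)).filter fun y => col x₀ y = g₁ with hZ₁
  have memZ₁ : ∀ y ∈ Z₁, y ∈ Y ∧ ¬ P y g₁ ∧ col x₀ y = g₁ := by
    intro y hy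
    simp only [hZ₁, Finset.mem_filter] at hy
    obtain ⟨⟨h1, h2⟩, h3⟩ := hy
    exact ⟨h1, h3 ▸ h2, h3⟩
  by_cases h1 : ∀ x ∈ K 1, (K 1).card ≤ (Z₁.filter fun y => P y (col x y) ∨ col x y = g₁).card
  · obtain ⟨q, hq, hq'⟩ := Finset.exists_injOn_of_card_le (K 1) Z₁ _ h1
    refine rescuable_of_injOn hA 1 (fun _ => g₁) q hq (fun x hx => (memZ₁ _ (hq' x hx).1).1)
      fun x hx => (hq' x hx).2.imp_right fun he => ?_
    exact ⟨0, x₀, hx₀, by decide, hdis 0 1 (by decide) _ hx₀, he.symm,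
      ((memZ₁ _ (hq' x hx).1).2.2).trans he.symm⟩
  push Not at h1
  obtain ⟨x₁, hx₁, hlt₁⟩ := h1
  have hmany₁ := few _ _ _ hlt₁
  obtain ⟨g₂, hg₂D, hg₂⟩ := Finset.exists_popular
    (Z₁.filter fun y => ¬ (P y (col x₁ y) ∨ col x₁ y = g₁)) (col x₁)
    (Finset.univ.erase g₁) (fun y hy => by
      rw [Finset.mem_filter] at hy
      simpa using fun h => hy.2 (Or.inr h)) ((K 2).card)
    (by rw [Finset.card_erase_of_mem (Finset.mem_univ _)]
        simp only [Finset.card_univ, Fintype.card_fin]; omega)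
  have hg₂ne : g₂ ≠ g₁ := by simpa using hg₂D
  set Z₂ := (Z₁.filter fun y => ¬ (P y (col x₁ y) ∨ col x₁ y = g₁)).filter
    fun y => col x₁ y = g₂ with hZ₂
  have memZ₂ : ∀ y ∈ Z₂, y ∈ Z₁ ∧ ¬ P y g₂ ∧ col x₁ y = g₂ := by
    intro y hy
    simp only [hZ₂, Finset.mem_filter, not_or] at hy
    obtain ⟨⟨h1, h2, -⟩, h3⟩ := hy
    exact ⟨h1, h3 ▸ h2, h3⟩
  obtain ⟨q, hq, hq'⟩ := Finset.exists_injOn_of_card_le (K 2) Z₂ (fun _ _ => True)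
    (fun x _ => by simpa using hg₂)
  have hx₀₁ : x₀ ≠ x₁ := fun h => hdis 0 1 (by decide) _ hx₀ (h ▸ hx₁)
  refine rescuable_of_injOn hA 2 (fun x => if x = x₀ then g₁ else g₂) q hq
    (fun x hx => (memZ₁ _ (memZ₂ _ (hq' x hx).1).1).1) fun x hx => ?_
  have m2 := memZ₂ _ (hq' x hx).1
  have m1 := memZ₁ _ m2.1
  by_cases e1 : col x (q x) = g₁
  · right
    exact ⟨0, x₀, hx₀, by decide, hdis 0 2 (by decide) _ hx₀, by rw [if_pos rfl, e1],
      m1.2.2.trans e1.symm⟩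
  by_cases e2 : col x (q x) = g₂
  · right
    exact ⟨1, x₁, hx₁, by decide, hdis 1 2 (by decide) _ hx₁, by rw [if_neg hx₀₁.symm, e2],
      m2.2.2.trans e2.symm⟩
  · left
    obtain ⟨k, hk⟩ := hP _ m1.1
    have k1 : k ≠ g₁ := fun h => m1.2.1 (h ▸ hk)
    have k2 : k ≠ g₂ := fun h => m2.2.1 (h ▸ hk)
    have : k = col x (q x) := Fin.eq_third hg₂ne (Ne.symm e1) (Ne.symm e2) k2 k1
    exact this ▸ hk

end Rescue

/-! ### Counting killed vertices -/

namespace BiColoring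

variable {V : Type*} {c : BiColoring V} {u : Fin 3 → V}

theorem Critical.exists_injective (h : c.Critical u) (b : Bool) (i : Fin 3) :
    ∃ e : Fin 3 → V, Function.Injective e ∧ ∀ j, c.Zone u i (e j) ∧ c.side (e j) = b := by
  obtain ⟨p, q, r, hp, hq, hr, hpz, hqz, hrz, hpq, hpr, hqr⟩ := h.exists_three i b
  have h1 : p ≠ q := fun he => hpq (he ▸ Linked.refl _)
  have h2 : p ≠ r := fun he => hpr (he ▸ Linked.refl _)
  have h3 : q ≠ r := fun he => hqr (he ▸ Linked.refl _)
  refine ⟨![p, q, r], ?_, ?_⟩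
  · intro a b hab
    fin_cases a <;> fin_cases b <;> simp_all
  · intro j
    fin_cases j
    exacts [⟨hpz, hp⟩, ⟨hqz, hq⟩, ⟨hrz, hr⟩]

section Counting

variable [Fintype V]

open Classical in
variable (c u) in
/-- The outer vertices on the side `b`. -/
noncomputable def outerSet (b : Bool) : Finset V :=
  Finset.univ.filter fun v => Outer c u v ∧ c.side v = b

open Classical in
variable (c u) in
/-- The vertices of zone `i` on the side `b`. -/
noncomputable def zoneSet (b : Bool) (i : Fin 3) : Finset V :=
  Finset.univ.filter fun v => c.Zone u i v ∧ c.side v = b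

open Classical in
variable (c u) in
/-- The outer vertices on the side `b` that cannot be attached to any part under the menu `s`. -/
noncomputable def killedSet (b : Bool) (s : Fin 3 → V) : Finset V :=
  (outerSet c u b).filter fun v => ∀ k, ¬ Avail c u s v k

theorem mem_outerSet {b : Bool} {v : V} : v ∈ outerSet c u b ↔ Outer c u v ∧ c.side v = b := by
  simp [outerSet]

theorem mem_zoneSet {b : Bool} {i : Fin 3} {v : V} :
    v ∈ zoneSet c u b i ↔ c.Zone u i v ∧ c.side v = b := by
  simp [zoneSet]

theorem mem_killedSet {b : Bool} {s : Fin 3 → V} {v : V} : v ∈ killedSet c u b s ↔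
    (Outer c u v ∧ c.side v = b) ∧ ∀ k, ¬ Avail c u s v k := by
  simp [killedSet, mem_outerSet]

theorem disjoint_killedSet {b : Bool} {s s' : Fin 3 → V} (hs : IsMenu c u (!b) s)
    (hs' : IsMenu c u (!b) s') (hne : s ≠ s') :
    Disjoint (killedSet c u b s) (killedSet c u b s') := by
  rw [Finset.disjoint_left]
  intro v hv hv'
  rw [mem_killedSet] at hv hv'
  exact hne (eq_of_killed hs hs' hv.1.1 hv.1.2 hv.2 hv'.2)

theorem sum_card_killedSet_le {ι : Type*} (I : Finset ι) {b : Bool} (s : ι → Fin 3 → V)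
    (hs : ∀ j ∈ I, IsMenu c u (!b) (s j)) (hinj : ∀ j ∈ I, ∀ j' ∈ I, s j = s j' → j = j') :
    ∑ j ∈ I, (killedSet c u b (s j)).card ≤ (outerSet c u b).card := by
  classical
  rw [← Finset.card_biUnion]
  · refine Finset.card_le_card (Finset.biUnion_subset.2 fun j _ => ?_)
    exact Finset.filter_subset _ _
  · intro j hj j' hj' hne
    exact disjoint_killedSet (hs j hj) (hs j' hj') fun h => hne (hinj j hj j' hj' h)

theorem card_side (h : c.Critical u) (b : Bool) :
    (Finset.univ.filter fun v => c.side v = b).card =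
      (outerSet c u b).card + ∑ i, (zoneSet c u b i).card := by
  classical
  rw [← Finset.card_biUnion, ← Finset.card_union_of_disjoint]
  · congr 1
    ext v
    simp only [Finset.mem_filter, Finset.mem_univ, true_and, Finset.mem_union, mem_outerSet,
      Finset.mem_biUnion, mem_zoneSet, Outer]
    by_cases hv : ∃ l, c.Zone u l v
    · obtain ⟨l, hl⟩ := hv
      exact ⟨fun hb => Or.inr ⟨l, hl, hb⟩, by rintro (⟨_, hb⟩ | ⟨_, _, hb⟩) <;> exact hb⟩
    · push Not at hv
      simp [hv]
  · rw [Finset.disjoint_left]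
    intro v hv hv'
    obtain ⟨i, -, hi⟩ := Finset.mem_biUnion.1 hv'
    exact (mem_outerSet.1 hv).1 i (mem_zoneSet.1 hi).1
  · intro i _ j _ hij
    refine Finset.disjoint_left.2 ?_
    intro v hv hv'
    exact h.zone_disjoint hij (mem_zoneSet.1 hv).1 (mem_zoneSet.1 hv').1

theorem Critical.three_le_card_zoneSet (h : c.Critical u) (b : Bool) (i : Fin 3) :
    3 ≤ (zoneSet c u b i).card := by
  classical
  obtain ⟨e, he, hz⟩ := h.exists_injective b i
  calc 3 = (Finset.univ.image e).card := by
        rw [Finset.card_image_of_injective _ he]; simp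
    _ ≤ _ := Finset.card_le_card (Finset.image_subset_iff.2 fun j _ => mem_zoneSet.2 (hz j))

/-- Three menus for the vertices on the side `b` such that a vertex killed by one of them is served
completely by the others, the other vertices have a common offer, and few vertices are killed. -/
theorem Critical.exists_menus (h : c.Critical u) (b : Bool) :
    ∃ s : Fin 3 → Fin 3 → V, (∀ m, IsMenu c u (!b) (s m)) ∧
      (∀ m, ∀ x ∈ killedSet c u b (s m), ∀ m', m' ≠ m → ∀ k, Avail c u (s m') x k) ∧
      (∀ x ∈ outerSet c u b, (∀ m, x ∉ killedSet c u b (s m)) →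
        ∃ k, ∀ m, Avail c u (s m) x k) ∧
      ((∀ m, (killedSet c u b (s m)).card = 0) ∨
        (27 * (2 * (killedSet c u b (s 0)).card + 4 * (killedSet c u b (s 1)).card +
          7 * (killedSet c u b (s 2)).card) ≤ 13 * (outerSet c u b).card ∧
        9 * ∑ i, (zoneSet c u (!b) i).card ≤ (outerSet c u b).card + 54)) := by
  classical
  by_cases hA : ∃ s, IsMenu c u (!b) s ∧ killedSet c u b s = ∅
  · obtain ⟨s, hs, hK⟩ := hA
    refine ⟨fun _ => s, fun _ => hs, ?_, ?_, Or.inl ?_⟩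
    · intro m x hx
      simp [hK] at hx
    · intro x hx _
      by_contra hcon
      have : x ∈ killedSet c u b s := mem_killedSet.2 ⟨mem_outerSet.1 hx, by simpa using hcon⟩
      simp [hK] at this
    · simp [hK]
  push Not at hA
  choose e he hz using h.exists_injective (!b)
  -- For each of the 27 shifts `t`, the three values of `m` give disjoint menus. For fixed `m` the
  -- 27 menus are distinct, so their killed sets are disjoint.
  let S : (Fin 3 → Fin 3) → Fin 3 → Fin 3 → V := fun t m i => e i (t i + m)
  have hS : ∀ t m, IsMenu c u (!b) (S t m) := fun t m i => hz i _
  have hSne : ∀ t m m', m ≠ m' → ∀ i, S t m i ≠ S t m' i := by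
    intro t m m' hm i hi
    exact hm (add_left_cancel (he i hi))
  have hsum : ∀ m, ∑ t, (killedSet c u b (S t m)).card ≤ (outerSet c u b).card := by
    intro m
    refine sum_card_killedSet_le Finset.univ (fun t => S t m) (fun t _ => hS t m) ?_
    intro t _ t' _ htt
    funext i
    exact add_right_cancel (he i (congrFun htt i))
  -- The weights 2, 4, 7 add the rescue weights 1, 3, 6 to the weights 1, 1, 1 of killed vertices
  -- lost as rescuers. Averaging over 27 shifts gives the factor 13/27.
  obtain ⟨t, -, ht⟩ : ∃ t ∈ (Finset.univ : Finset (Fin 3 → Fin 3)),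
      27 * (2 * (killedSet c u b (S t 0)).card + 4 * (killedSet c u b (S t 1)).card +
        7 * (killedSet c u b (S t 2)).card) ≤ 13 * (outerSet c u b).card := by
    apply Finset.exists_le_of_sum_le Finset.univ_nonempty
    rw [← Finset.mul_sum, Finset.sum_add_distrib, Finset.sum_add_distrib, ← Finset.mul_sum,
      ← Finset.mul_sum, ← Finset.mul_sum]
    have h0 := hsum 0
    have h1 := hsum 1
    have h2 := hsum 2
    have hc : ∑ _t : Fin 3 → Fin 3, 13 * (outerSet c u b).card =
        27 * (13 * (outerSet c u b).card) := by
      simp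
    rw [hc]
    omega
  refine ⟨S t, hS t, ?_, ?_, Or.inr ⟨ht, ?_⟩⟩
  · intro m x hx m' hm k
    rw [mem_killedSet] at hx
    exact avail_of_killed (hS t m) hx.1.1 hx.1.2 hx.2 (hSne t m m' hm.symm) k
  · intro x hx hK
    rw [mem_outerSet] at hx
    refine exists_common_avail (hS t) (hSne t) hx.1 hx.2 fun m => ?_
    have := hK m
    rw [mem_killedSet] at this
    by_contra hcon
    exact this ⟨hx, by simpa using hcon⟩
  -- Every menu kills someone here, and the killed sets are disjoint, so the outer vertices are at
  -- least as many as the menus.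
  · have hprod : ∏ i, (zoneSet c u (!b) i).card ≤ (outerSet c u b).card := by
      rw [← Fintype.card_piFinset]
      have hmenu : ∀ s ∈ Fintype.piFinset (zoneSet c u (!b)), IsMenu c u (!b) s :=
        fun s hs i => mem_zoneSet.1 (Fintype.mem_piFinset.1 hs i)
      refine le_trans ?_ (sum_card_killedSet_le (Fintype.piFinset (zoneSet c u (!b))) id hmenu
        fun _ _ _ _ h => h)
      rw [Finset.card_eq_sum_ones]
      exact Finset.sum_le_sum fun s hs => Finset.card_pos.2 (hA s (hmenu s hs))
    rw [Fin.prod_univ_three] at hprod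
    rw [Fin.sum_univ_three]
    obtain ⟨x, hx⟩ := Nat.exists_eq_add_of_le (h.three_le_card_zoneSet (!b) 0)
    obtain ⟨y, hy⟩ := Nat.exists_eq_add_of_le (h.three_le_card_zoneSet (!b) 1)
    obtain ⟨z, hz⟩ := Nat.exists_eq_add_of_le (h.three_le_card_zoneSet (!b) 2)
    rw [hx, hy, hz] at hprod ⊢
    have : (3 + x) * (3 + y) * (3 + z) =
        27 + 9 * (x + y + z) + (3 * (x * y + y * z + x * z) + x * y * z) := by ring
    omega

end Counting

/-! ### Assembling the partition -/

theorem partitionable_of_balanced [Fintype V] [Nonempty V]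
    (hbal : (Finset.univ.filter fun v => c.side v = true).card =
      (Finset.univ.filter fun v => c.side v = false).card)
    (hdeg : c.FullDegree) : c.Partitionable := by
  classical
  by_contra hP
  obtain ⟨u, hu⟩ := exists_triple hP hdeg
  have h : c.Critical u := ⟨hP, hdeg, hu⟩
  apply hP
  choose s hs hkill hcommon hfew using h.exists_menus
  let ℓ : Fin 3 → V := fun i => if hi : ∃ v, Critical.IsLink c u i v then hi.choose else u i
  have hℓ : ∀ i, (∃ v, Critical.IsLink c u i v) → Critical.IsLink c u i (ℓ i) := by
    intro i hi
    simp only [ℓ, dif_pos hi]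
    exact hi.choose_spec
  let L : Finset V := Finset.univ.image ℓ
  have hL : L.card ≤ 3 := Finset.card_image_le.trans (by simp)
  -- the vertices on the side opposite to `b` that may serve as rescuers
  let K : Bool → Fin 3 → Finset V := fun b m => killedSet c u b (s b m)
  -- Selected links are excluded because their colours are prescribed, killed vertices because they
  -- need rescue themselves.
  let Y : Bool → Finset V := fun b => outerSet c u (!b) \ ((Finset.univ.biUnion (K (!b))) ∪ L)
  have hYcard : ∀ b, (outerSet c u (!b)).card ≤
      (Y b).card + ((K (!b) 0).card + (K (!b) 1).card + (K (!b) 2).card + 3) := by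
    intro b
    have h1 := Finset.le_card_sdiff ((Finset.univ.biUnion (K (!b))) ∪ L) (outerSet c u (!b))
    have h2 := Finset.card_union_le (Finset.univ.biUnion (K (!b))) L
    have h3 : (Finset.univ.biUnion (K (!b))).card ≤ _ := Finset.card_biUnion_le
    rw [Fin.sum_univ_three] at h3
    simp only [Y]
    omega
  have hcard : ∀ b, (K b 0).card + 3 * (K b 1).card + 6 * (K b 2).card ≤ (Y b).card := by
    intro b
    have hY := hYcard b
    have f1 := hfew b
    have f2 := hfew (!b)
    have hz : ∀ b, 9 ≤ ∑ i, (zoneSet c u b i).card := by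
      intro b
      rw [Fin.sum_univ_three]
      have := h.three_le_card_zoneSet b 0
      have := h.three_le_card_zoneSet b 1
      have := h.three_le_card_zoneSet b 2
      omega
    have z1 := hz b
    have z2 := hz (!b)
    have hb : (outerSet c u b).card + ∑ i, (zoneSet c u b i).card =
        (outerSet c u (!b)).card + ∑ i, (zoneSet c u (!b) i).card := by
      rw [← card_side h, ← card_side h]
      cases b
      · exact hbal.symm
      · exact hbal
    rw [Bool.not_not] at f2
    simp only [K] at hY ⊢
    rcases f1 with f1 | ⟨f1, f1'⟩
    · rw [f1 0, f1 1, f1 2]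
      omega
    rcases f2 with f2 | ⟨f2, f2'⟩
    · rw [f2 0, f2 1, f2 2] at hY
      omega
    · omega
  have memY : ∀ b y, y ∈ Y b → Outer c u y ∧ c.side y = (!b) ∧
      (∀ m, y ∉ K (!b) m) ∧ y ∉ L := by
    intro b y hy
    simp only [Y, Finset.mem_sdiff, Finset.mem_union, Finset.mem_biUnion, Finset.mem_univ,
      true_and, not_or, not_exists] at hy
    exact ⟨(mem_outerSet.1 hy.1).1, (mem_outerSet.1 hy.1).2, hy.2.1, hy.2.2⟩
  -- A rescuer's own colour must be offered by all three menus of its side, which decouples the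
  -- final choices of menu on the two sides.
  have hres : ∀ b, Rescuable c.col (fun m => Avail c u (s b m))
      (fun y k => ∀ m, Avail c u (s (!b) m) y k) (K b) (Y b) := by
    intro b
    refine rescuable_of_card (hkill b) (fun m x hx => (mem_killedSet.1 hx).2) ?_ (hcard b)
    intro y hy
    obtain ⟨h1, h2, h3, -⟩ := memY b y hy
    exact hcommon (!b) y (mem_outerSet.2 ⟨h1, h2⟩) h3
  choose m F₀ H Q hQY hF₀ hH using hres
  let F : V → Fin 3 := fun v =>
    if hl : ∃ i, Critical.IsLink c u i v ∧ v = ℓ i then hl.choose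
    else if ∃ l, v ∈ K (c.side v) l then F₀ (c.side v) v
    else if v ∈ Q (!c.side v) then H (!c.side v) v
    else if hk : ∃ k, ∀ m, Avail c u (s (c.side v) m) v k then hk.choose else 0
  have Flink : ∀ i v, Critical.IsLink c u i v → v = ℓ i → F v = i := by
    intro i v hv he
    have hl : ∃ i, Critical.IsLink c u i v ∧ v = ℓ i := ⟨i, hv, he⟩
    simp only [F, dif_pos hl]
    exact IsLink.unique h hl.choose_spec.1 hv
  have Fkilled : ∀ b l x, x ∈ K b l → F x = F₀ b x ∧ Outer c u x ∧ c.side x = b := by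
    intro b l x hx
    have hx' := mem_killedSet.1 hx
    have hxb : c.side x = b := hx'.1.2
    subst hxb
    have hl : ¬ ∃ i, Critical.IsLink c u i x ∧ x = ℓ i := by
      rintro ⟨i, hi, -⟩
      exact hx'.2 i (IsLink.avail (hs (c.side x) l) rfl hi)
    have hk : ∃ l, x ∈ K (c.side x) l := ⟨l, hx⟩
    exact ⟨by simp only [F, dif_neg hl, if_pos hk], hx'.1.1, rfl⟩
  have FQ : ∀ b y, y ∈ Q b → F y = H b y ∧ Outer c u y ∧ c.side y = !b := by
    intro b y hy
    obtain ⟨h1, h2, h3, h4⟩ := memY b y (hQY b hy)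
    have hl : ¬ ∃ i, Critical.IsLink c u i y ∧ y = ℓ i := by
      rintro ⟨i, -, hi⟩
      exact h4 (Finset.mem_image.2 ⟨i, Finset.mem_univ _, hi.symm⟩)
    have hk : ¬ ∃ l, y ∈ K (c.side y) l := by
      rw [h2]
      simpa using h3
    have hq : y ∈ Q (!c.side y) := by simpa [h2] using hy
    refine ⟨?_, h1, h2⟩
    simp only [F, dif_neg hl, if_neg hk, if_pos hq]
    rw [h2, Bool.not_not]
  refine h.partitionable_of_outer (fun b => s (!b) (m (!b)))
    (fun b => by simpa using hs (!b) (m (!b))) F ?_ ?_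
  · intro i
    by_cases hi : ∃ v, Critical.IsLink c u i v
    · exact Or.inl ⟨ℓ i, hℓ i hi, Flink i _ (hℓ i hi) rfl⟩
    · push Not at hi
      exact Or.inr hi
  · simp only [Bool.not_not]
    set R : V → V → Prop := fun a b => Outer c u a ∧ Outer c u b ∧ F a = F b ∧ c.Step (F a) a b
    have hQ : ∀ b, ∀ y ∈ Q b, ∃ w, Outer c u w ∧ Relation.ReflTransGen R y w ∧
        Avail c u (s (c.side w) (m (c.side w))) w (F w) := by
      intro b y hy
      obtain ⟨hFy, hyo, hyb⟩ := FQ b y hy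
      rcases hH b y hy with hA | ⟨l, x, hx, hA, hFx, hcol⟩
      · refine ⟨y, hyo, Relation.ReflTransGen.refl, ?_⟩
        rw [hFy, hyb]
        exact hA _
      · obtain ⟨hFx', hxo, hxb⟩ := Fkilled b l x hx
        refine ⟨x, hxo, Relation.ReflTransGen.single ⟨hyo, hxo, ?_, ?_⟩, ?_⟩
        · rw [hFy, hFx', hFx]
        · exact Step.symm ⟨by simp [hxb, hyb], by rw [hcol, hFy]⟩
        · rw [hFx', hxb]
          exact hA
    intro v hv
    by_cases hl : ∃ i, Critical.IsLink c u i v ∧ v = ℓ i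
    · obtain ⟨i, hi, he⟩ := hl
      refine ⟨v, hv, Relation.ReflTransGen.refl, ?_⟩
      rw [Flink i v hi he]
      exact IsLink.avail (hs _ _) rfl hi
    by_cases hk : ∃ l, v ∈ K (c.side v) l
    · obtain ⟨l, hvl⟩ := hk
      obtain ⟨hFv, -, -⟩ := Fkilled _ l v hvl
      rcases hF₀ _ l v hvl with hA | ⟨y, hy, hFy, hcol⟩
      · refine ⟨v, hv, Relation.ReflTransGen.refl, ?_⟩
        rw [hFv]
        exact hA
      · obtain ⟨w, hw, hyw, hA⟩ := hQ _ y hy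
        obtain ⟨hFy', hyo, hyb⟩ := FQ _ y hy
        refine ⟨w, hw, Relation.ReflTransGen.head ⟨hv, hyo, ?_, ?_⟩ hyw, hA⟩
        · rw [hFv, hFy', hFy]
        · exact ⟨by simp [hyb], by rw [hcol, hFv, hFy]⟩
    by_cases hq : v ∈ Q (!c.side v)
    · exact hQ _ v hq
    · refine ⟨v, hv, Relation.ReflTransGen.refl, ?_⟩
      have hex := hcommon (c.side v) v (mem_outerSet.2 ⟨hv, rfl⟩) (by simpa [K] using hk)
      have : F v = hex.choose := by
        simp only [F, dif_neg hl, if_neg hk, if_neg hq, dif_pos hex]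
      rw [this]
      exact hex.choose_spec _

end BiColoring

theorem theorem7 (n : ℕ) (hn : 3 ≤ n) :
    MonoTree.IsTreePartitionNumber (completeBipartiteGraph (Fin n) (Fin n)) 3
      (fun c => ∀ v : Fin n ⊕ Fin n, MonoTree.colorDegree c v = 3) 3 := by
  constructor
  · intro c hc
    apply BiColoring.coverable_of_partitionable
    have : Nonempty (Fin n ⊕ Fin n) := ⟨Sum.inl ⟨0, by omega⟩⟩
    apply BiColoring.partitionable_of_balanced
    · refine Finset.card_equiv (Equiv.sumComm _ _) ?_
      rintro (v | v) <;> simp [BiColoring.ofLabeling]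
    · exact fun v k => BiColoring.exists_step_of_colorDegree c (hc v) k
  · intro k hk
    exact three_le_of_coverable_latinLabeling hn (hk _ (colorDegree_latinLabeling hn))
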